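/- For a finite non-empty graph $G$ and $\lambda>0$, let $\mathcal I(G)$ be the set of independent sets of $G$ (including $\emptyset$), let $P_G(\lambda)=\sum_{I\in\mathcal I(G)}\lambda^{|I|}$, and let \[ \alpha_G(\lambda)=\frac{1}{|V(G)|}\sum_{I\in\mathcal I(G)}\frac{\lambda^{|I|}}{P_G(\lambda)}\,|I| \] be the occupancy fraction of $G$, i.e. the expected fraction of the vertices of $G$ that lie in a random independent set drawn from the hard-core model at fugacity $\lambda$. Let $H_{3,6}$ denote the Heawood graph, the point-line incidence graph of the Fano plane. For every non-empty finite simple cubic (that is, $3$-regular) graph $G$ of girth at least $5$ and every $\lambda>0$, \[ \alpha_G(\lambda)\le\alpha_{H_{3,6}}(\lambda), \] with equality if and only if $G$ is isomorphic to a disjoint union of copies of $H_{3,6}$. -/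

import Mathlib

namespace HardCore

/-- The finset of all independent sets of a finite graph (the empty set included). -/
def indepSets {V : Type*} [Fintype V] [DecidableEq V]
    (G : SimpleGraph V) [DecidableRel G.Adj] : Finset (Finset V) :=
  Finset.univ.filter fun I : Finset V => G.IsIndepSet (I : Set V)

/-- The independence polynomial `P_G(t) = ∑_I t ^ |I|`, summed over independent sets `I`. -/
def indepPoly {V : Type*} [Fintype V] [DecidableEq V]
    (G : SimpleGraph V) [DecidableRel G.Adj] (t : ℝ) : ℝ :=
  ∑ I ∈ indepSets G, t ^ I.card

/-- The probability of the independent set `I` in the hard-core model at fugacity `t`. -/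
noncomputable def prob {V : Type*} [Fintype V] [DecidableEq V]
    (G : SimpleGraph V) [DecidableRel G.Adj] (t : ℝ) (I : Finset V) : ℝ :=
  t ^ I.card / indepPoly G t

/-- The occupancy fraction: the expected fraction of the vertices of `G` that belong to a random
independent set drawn from the hard-core model at fugacity `t`. -/
noncomputable def occupancyFraction {V : Type*} [Fintype V] [DecidableEq V]
    (G : SimpleGraph V) [DecidableRel G.Adj] (t : ℝ) : ℝ :=
  (1 / (Fintype.card V : ℝ)) * ∑ I ∈ indepSets G, prob G t I * (I.card : ℝ)

/-- Incidence in the Fano plane with points and lines both indexed by `ZMod 7`: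
the line `l` consists of the points `l`, `l + 1` and `l + 3`. -/
def fanoIncident (p l : ZMod 7) : Prop := p = l ∨ p = l + 1 ∨ p = l + 3

instance instDecidableFanoIncident (p l : ZMod 7) : Decidable (fanoIncident p l) :=
  inferInstanceAs (Decidable (p = l ∨ p = l + 1 ∨ p = l + 3))

/-- Adjacency in the Heawood graph: `Sum.inl p` is a point, `Sum.inr l` a line of the Fano plane,
and edges join points to the lines through them. -/
def heawoodAdj : ZMod 7 ⊕ ZMod 7 → ZMod 7 ⊕ ZMod 7 → Prop
  | Sum.inl p, Sum.inr l => fanoIncident p l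
  | Sum.inr l, Sum.inl p => fanoIncident p l
  | Sum.inl _, Sum.inl _ => False
  | Sum.inr _, Sum.inr _ => False

instance instDecidableRelHeawoodAdj : DecidableRel heawoodAdj
  | Sum.inl p, Sum.inr l => inferInstanceAs (Decidable (fanoIncident p l))
  | Sum.inr l, Sum.inl p => inferInstanceAs (Decidable (fanoIncident p l))
  | Sum.inl _, Sum.inl _ => inferInstanceAs (Decidable False)
  | Sum.inr _, Sum.inr _ => inferInstanceAs (Decidable False)

/-- The Heawood graph: the point-line incidence graph of the Fano plane. -/
def heawood : SimpleGraph (ZMod 7 ⊕ ZMod 7) where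
  Adj := heawoodAdj
  symm := ⟨by rintro (a | a) (b | b) h <;> exact h⟩
  loopless := ⟨by rintro (a | a) h <;> exact h⟩

instance instDecidableRelHeawood : DecidableRel heawood.Adj :=
  inferInstanceAs (DecidableRel heawoodAdj)

/-- The disjoint union of `k` copies of the graph `H`. -/
def copies {W : Type*} (k : ℕ) (H : SimpleGraph W) : SimpleGraph (Fin k × W) where
  Adj x y := x.1 = y.1 ∧ H.Adj x.2 y.2
  symm := ⟨fun _ _ h => ⟨h.1.symm, h.2.symm⟩⟩
  loopless := ⟨fun _ h => H.irrefl h.2⟩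

/-- `G` is a disjoint union of (finitely many) copies of `H`, up to isomorphism. -/
def IsUnionOfCopies {V W : Type*} (G : SimpleGraph V) (H : SimpleGraph W) : Prop :=
  ∃ k : ℕ, Nonempty (G ≃g copies k H)

end HardCore

/-!
The proof is linear programming duality for the hard-core model seen from a vertex `v` up to
distance two. For an independent set `I` let `occ I x` be the number of neighbours of `x` in `I`.
Given multipliers `L 0 = 0, L 1, L 2, L 3` (`multiplier`) and `A = occNum`, `D = occDen`, the charge

  `3 A - 3 D [v ∈ I] - 3 L (occ I v) + ∑ u ~ v, L (occ I u)`

sums over all `v` to `3 (n A - D |I|)`, as the `L`-terms cancel in a cubic graph (`sum_charge`).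
Averaging over `I`, the occupancy fraction is `A / D` minus a positive multiple of `∑ v, slack v`,
where `slack v` is the weighted sum of the charge at `v` (`occupancyFraction_eq`). So the bound
follows once each slack is nonnegative, and equality holds iff each slack vanishes.

Fix `v` with neighbours `u i` and second neighbours `w i b` (`Labelling`). The sum over `I` is split
according to `J`, the part of `I` at distance at least three. Without triangles and squares,
what remains of the sum for a given `J` depends only on which `w i b` have no neighbour in `J` and
on the edges between the `w i b`, which form a partial matching between any two branches. The
outcome is `t ^ 5` times a polynomial in `t` (`Labelling.slack_eq`), which has only nonnegative
coefficients for each of the finitely many patterns: `goodConfig_all`, a kernel computation. The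
multipliers are the unique choice for which the four availability patterns of the Heawood graph
(none, one, one in each branch, or all second neighbours available) give the zero polynomial.

If the slack vanishes at `v`, the polynomial for `J = ∅` forces the second neighbours to span no
edge, and those for the singletons `J = {x}` force each `x` at distance three to be joined to
every branch. Since two vertices share at most one neighbour, this makes the neighbourhood of `v` a
copy of the Heawood graph (`Labelling.exists_embedding`), which is a whole component by
regularity. Conversely a vertex in a Heawood component has slack zero (`slack_embedding`). Applied to
the Heawood graph itself this identifies its occupancy fraction as `A / D`, with no need to
compute its independence polynomial.
-/

set_option linter.unusedSectionVars false

namespace HardCore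

open Finset

/-! ### Polynomials as coefficient lists, and the finite check -/

/-- The value at `t` of the polynomial with the given list of coefficients, constant term first. -/
def evalP (t : ℝ) : List ℤ → ℝ
  | [] => 0
  | c :: p => c + t * evalP t p

/-- Addition of polynomials given by coefficient lists. -/
def addP : List ℤ → List ℤ → List ℤ
  | [], q => q
  | c :: p, [] => c :: p
  | c :: p, d :: q => (c + d) :: addP p q

theorem evalP_addP (t : ℝ) (p q : List ℤ) : evalP t (addP p q) = evalP t p + evalP t q := by
  induction p generalizing q with
  | nil => simp [addP, evalP]
  | cons c p ih =>
    cases q with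
    | nil => simp [addP, evalP]
    | cons d q => simp only [addP, evalP, ih]; push_cast; ring

theorem evalP_nonneg {t : ℝ} (ht : 0 < t) {p : List ℤ} (hp : (p.all fun c => decide (0 ≤ c)) = true) :
    0 ≤ evalP t p := by
  induction p with
  | nil => simp [evalP]
  | cons c p ih =>
    simp only [List.all_cons, Bool.and_eq_true, decide_eq_true_eq] at hp
    have h1 : (0 : ℝ) ≤ c := by exact_mod_cast hp.1
    have := ih hp.2
    simp only [evalP]; positivity

theorem evalP_pos {t : ℝ} (ht : 0 < t) {p : List ℤ} (hp : (p.all fun c => decide (0 ≤ c)) = true)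
    (hq : (p.any fun c => decide (0 < c)) = true) : 0 < evalP t p := by
  induction p with
  | nil => simp at hq
  | cons c p ih =>
    have h0 := hp
    simp only [List.all_cons, Bool.and_eq_true, decide_eq_true_eq] at hp
    have h1 : (0 : ℝ) ≤ c := by exact_mod_cast hp.1
    have h2 := evalP_nonneg ht hp.2
    simp only [List.any_cons, Bool.or_eq_true, decide_eq_true_eq] at hq
    simp only [evalP]
    rcases hq with hq | hq
    · have : (0 : ℝ) < c := by exact_mod_cast hq
      positivity
    · have := ih hp.2 hq
      positivity

theorem evalP_eq_zero (t : ℝ) {p : List ℤ} (hp : (p.all fun c => decide (c = 0)) = true) :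
    evalP t p = 0 := by
  induction p with
  | nil => simp [evalP]
  | cons c p ih =>
    simp only [List.all_cons, Bool.and_eq_true, decide_eq_true_eq] at hp
    simp [evalP, ih hp.2, hp.1]

/-- The sum of a list of polynomials indexed by a list. -/
def sumP {α : Type*} (l : List α) (f : α → List ℤ) : List ℤ :=
  l.foldr (fun x r => addP (f x) r) []

theorem evalP_sumP {α : Type*} (t : ℝ) (l : List α) (f : α → List ℤ) :
    evalP t (sumP l f) = (l.map fun x => evalP t (f x)).sum := by
  induction l with
  | nil => simp [sumP, evalP]
  | cons x l ih =>
    simp only [sumP, List.foldr_cons, evalP_addP, List.map_cons, List.sum_cons] at ih ⊢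
    rw [ih]

/-- The number of elements of a pair selected by two Booleans. In this section a pair of Booleans
describes a subset of the two second neighbours behind a fixed neighbour of the root. -/
def cnt (s : Bool × Bool) : ℕ := s.1.toNat + s.2.toNat

/-- Subsets of the available elements of a pair. -/
def opts : Bool × Bool → List (Bool × Bool)
  | (false, false) => [(false, false)]
  | (true, false) => [(false, false), (true, false)]
  | (false, true) => [(false, false), (false, true)]
  | (true, true) => [(false, false), (true, false), (false, true), (true, true)]

/-- Four Booleans recording the edges between two pairs, in the order `00, 01, 10, 11`. -/
abbrev Edges := (Bool × Bool) × (Bool × Bool)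

/-- Whether the selected elements of two pairs span an edge. -/
def hits (e : Edges) (s r : Bool × Bool) : Bool :=
  (e.1.1 && s.1 && r.1) || (e.1.2 && s.1 && r.2) || (e.2.1 && s.2 && r.1) || (e.2.2 && s.2 && r.2)

/-- The contribution of a set of second neighbours with `a`, `b`, `c` elements in the three branches,
divided by `t ^ 5`; see `pow_mul_weight`. -/
def weightTab : ℕ → ℕ → ℕ → List ℤ
  | 0, 0, 0 => []
  | 1, 0, 0 => []
  | 0, 1, 0 => []
  | 0, 0, 1 => []
  | 1, 1, 0 => [0, 3, 23, 61, 71, 41, 13, 2]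
  | 1, 0, 1 => [0, 3, 23, 61, 71, 41, 13, 2]
  | 0, 1, 1 => [0, 3, 23, 61, 71, 41, 13, 2]
  | 1, 1, 1 => [0, -9, -69, -183, -213, -123, -39, -6]
  | 2, 0, 0 => [12, 102, 342, 589, 573, 324, 104, 17, 1]
  | 0, 2, 0 => [12, 102, 342, 589, 573, 324, 104, 17, 1]
  | 0, 0, 2 => [12, 102, 342, 589, 573, 324, 104, 17, 1]
  | 2, 1, 0 => [-3, -15, -1, 115, 266, 261, 126, 30, 3]
  | 2, 0, 1 => [-3, -15, -1, 115, 266, 261, 126, 30, 3]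
  | 1, 2, 0 => [-3, -15, -1, 115, 266, 261, 126, 30, 3]
  | 0, 2, 1 => [-3, -15, -1, 115, 266, 261, 126, 30, 3]
  | 1, 0, 2 => [-3, -15, -1, 115, 266, 261, 126, 30, 3]
  | 0, 1, 2 => [-3, -15, -1, 115, 266, 261, 126, 30, 3]
  | 2, 1, 1 => [0, -6, -48, -155, -259, -224, -100, -26, -4]
  | 1, 2, 1 => [0, -6, -48, -155, -259, -224, -100, -26, -4]
  | 1, 1, 2 => [0, -6, -48, -155, -259, -224, -100, -26, -4]
  | 2, 2, 0 => [0, -6, -30, -5, 207, 471, 451, 211, 47, 4]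
  | 2, 0, 2 => [0, -6, -30, -5, 207, 471, 451, 211, 47, 4]
  | 0, 2, 2 => [0, -6, -30, -5, 207, 471, 451, 211, 47, 4]
  | 2, 2, 1 => [0, 0, -12, -87, -241, -335, -235, -77, -13, -2]
  | 2, 1, 2 => [0, 0, -12, -87, -241, -335, -235, -77, -13, -2]
  | 1, 2, 2 => [0, 0, -12, -87, -241, -335, -235, -77, -13, -2]
  | 2, 2, 2 => [0, 0, 0, -18, -126, -327, -411, -246, -54]
  | _, _, _ => []

/-- The polynomial weight of a configuration: `weightTab` summed over all independent sets of
available second neighbours. `aᵢ` records which elements of branch `i` are available and `eᵢⱼ` the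
edges between branches `i` and `j`. -/
def coefs (a₀ a₁ a₂ : Bool × Bool) (e₀₁ e₀₂ e₁₂ : Edges) : List ℤ :=
  sumP (opts a₀) fun s₀ => sumP (opts a₁) fun s₁ => bif hits e₀₁ s₀ s₁ then [] else
    sumP (opts a₂) fun s₂ => bif hits e₀₂ s₀ s₂ || hits e₁₂ s₁ s₂ then [] else
      weightTab (cnt s₀) (cnt s₁) (cnt s₂)

/-- Partial matchings between the available elements of two pairs. -/
def matchings : Bool × Bool → Bool × Bool → List Edges := fun a b =>
  ([((false, false), (false, false)), ((true, false), (false, false)),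
    ((false, true), (false, false)), ((false, false), (true, false)),
    ((false, false), (false, true)), ((true, false), (false, true)),
    ((false, true), (true, false))] : List Edges).filter fun e =>
      (!e.1.1 || (a.1 && b.1)) && (!e.1.2 || (a.1 && b.2)) &&
        (!e.2.1 || (a.2 && b.1)) && (!e.2.2 || (a.2 && b.2))

/-- The empty set of edges between two pairs. -/
def noEdge : Edges := ((false, false), (false, false))

/-- The coefficients `c` are nonnegative; and if all vanish, then full availability excludes edges,
while absence of edges leaves only the availability patterns of the Heawood graph. -/
def goodConfig (a₀ a₁ a₂ : Bool × Bool) (e₀₁ e₀₂ e₁₂ : Edges) (c : List ℤ) : Bool :=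
  (c.all fun x => decide (0 ≤ x)) && ((c.any fun x => decide (0 < x)) ||
    ((!(decide (cnt a₀ = 2 ∧ cnt a₁ = 2 ∧ cnt a₂ = 2)) ||
      decide (e₀₁ = noEdge ∧ e₀₂ = noEdge ∧ e₁₂ = noEdge)) &&
     (!(decide (e₀₁ = noEdge ∧ e₀₂ = noEdge ∧ e₁₂ = noEdge)) ||
      decide ((cnt a₀ = 2 ∧ cnt a₁ = 2 ∧ cnt a₂ = 2) ∨ (cnt a₀ = 1 ∧ cnt a₁ = 1 ∧ cnt a₂ = 1) ∨
        cnt a₀ + cnt a₁ + cnt a₂ ≤ 1))))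

/-- All pairs of Booleans, as an explicit list so that the kernel can run through it quickly. -/
def boolPairs : List (Bool × Bool) := [(false, false), (true, false), (false, true), (true, true)]

/-- The finite check behind dual feasibility and its equality case. -/
theorem goodConfig_all : (boolPairs.all fun a₀ => boolPairs.all fun a₁ => boolPairs.all fun a₂ =>
    (matchings a₀ a₁).all fun e₀₁ => (matchings a₀ a₂).all fun e₀₂ => (matchings a₁ a₂).all fun e₁₂ =>
      goodConfig a₀ a₁ a₂ e₀₁ e₀₂ e₁₂ (coefs a₀ a₁ a₂ e₀₁ e₀₂ e₁₂)) = true := by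
  decide +kernel

/-! ### Dual weights and the real sums they compute -/

/-- A common denominator of the dual solution, equal to `(1 + t) (2 + t) P(t)` where `P` is the
independence polynomial of the Heawood graph. -/
def occDen (t : ℝ) : ℝ :=
  (1 + t) * (2 + 29 * t + 154 * t ^ 2 + 378 * t ^ 3 + 448 * t ^ 4 + 259 * t ^ 5 + 84 * t ^ 6 +
    18 * t ^ 7 + 2 * t ^ 8)

/-- `occNum t / occDen t` is the occupancy fraction of the Heawood graph
(`occupancyFraction_heawood`). -/
def occNum (t : ℝ) : ℝ :=
  (1 + t) * t * (2 + 21 * t + 76 * t ^ 2 + 117 * t ^ 3 + 82 * t ^ 4 + 32 * t ^ 5 + 8 * t ^ 6 +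
    t ^ 7)

/-- The dual variables, scaled by `occDen`: `multiplier t j` is attached to the constraint that a
uniform vertex and a uniform neighbour of it are equally likely to have exactly `j` occupied
neighbours. -/
def multiplier (t : ℝ) : ℕ → ℝ
  | 1 => t ^ 2 * (3 + 33 * t + 104 * t ^ 2 + 101 * t ^ 3 + 6 * t ^ 4 - 25 * t ^ 5 - 7 * t ^ 6)
  | 2 => t * (3 + 27 * t + 115 * t ^ 2 + 272 * t ^ 3 + 317 * t ^ 4 + 173 * t ^ 5 + 47 * t ^ 6 +
      8 * t ^ 7 + t ^ 8)
  | 3 => -3 - 27 * t - 94 * t ^ 2 - 139 * t ^ 3 - 20 * t ^ 4 + 139 * t ^ 5 + 124 * t ^ 6 +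
      45 * t ^ 7 + 9 * t ^ 8 + t ^ 9
  | _ => 0

theorem occDen_pos {t : ℝ} (ht : 0 < t) : 0 < occDen t := by unfold occDen; positivity

/-- The charge of the root summed over all ways to occupy vertices of its closed neighbourhood, where
`N` is the set of neighbours and `c u` counts the occupied second neighbours behind `u`. The first
term has the root occupied; in the second, `U` is the set of occupied neighbours. -/
def localWeight {V : Type*} (t : ℝ) (N : Finset V) (c : V → ℕ) : ℝ :=
  t * (3 * occNum t - 3 * occDen t + ∑ u ∈ N, multiplier t (c u + 1)) +
    ∑ U ∈ (N.filter fun u => c u = 0).powerset,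
      t ^ U.card * (3 * occNum t - 3 * multiplier t U.card + ∑ u ∈ N, multiplier t (c u))

/-- The table `weightTab` is correct; the sum over occupied neighbours is grouped by their number `m`. -/
theorem pow_mul_weight (t : ℝ) {a b c : ℕ} (ha : a ≤ 2) (hb : b ≤ 2) (hc : c ≤ 2) :
    t ^ (a + b + c) * (t * (3 * occNum t - 3 * occDen t +
      (multiplier t (a + 1) + multiplier t (b + 1) + multiplier t (c + 1))) +
      ∑ m ∈ range ((if a = 0 then 1 else 0) + (if b = 0 then 1 else 0) +
          (if c = 0 then 1 else 0) + 1),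
        (((if a = 0 then 1 else 0) + (if b = 0 then 1 else 0) +
          (if c = 0 then 1 else 0)).choose m : ℝ) * (t ^ m * (3 * occNum t - 3 * multiplier t m +
          (multiplier t a + multiplier t b + multiplier t c)))) =
      t ^ 5 * evalP t (weightTab a b c) := by
  interval_cases a <;> interval_cases b <;> interval_cases c <;>
    simp [-mul_eq_mul_left_iff, -mul_eq_mul_right_iff, -mul_eq_zero, sum_range_succ, weightTab,
      evalP, multiplier, occNum, occDen, Nat.choose] <;> ring

theorem pow_mul_localWeight {V : Type*} [DecidableEq V] (t : ℝ) {u : Fin 3 → V}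
    (hu : Function.Injective u) (c : V → ℕ) (hc : ∀ i, c (u i) ≤ 2) :
    t ^ (c (u 0) + c (u 1) + c (u 2)) * localWeight t (univ.image u) c =
      t ^ 5 * evalP t (weightTab (c (u 0)) (c (u 1)) (c (u 2))) := by
  rw [← pow_mul_weight t (hc 0) (hc 1) (hc 2), localWeight,
    sum_powerset_apply_card (fun m => t ^ m * (3 * occNum t - 3 * multiplier t m +
      ∑ x ∈ univ.image u, multiplier t (c x)))]
  have hcard : ((univ.image u).filter fun x => c x = 0).card =
      (if c (u 0) = 0 then 1 else 0) + (if c (u 1) = 0 then 1 else 0) +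
        (if c (u 2) = 0 then 1 else 0) := by
    rw [card_filter, sum_image fun i _ j _ h => hu h, Fin.sum_univ_three]
  rw [hcard, sum_image fun i _ j _ h => hu h, sum_image fun i _ j _ h => hu h,
    Fin.sum_univ_three, Fin.sum_univ_three]
  simp only [nsmul_eq_mul]

/-- Whether the selection `s` uses available elements only. -/
def within (s a : Bool × Bool) : Bool := (!s.1 || a.1) && (!s.2 || a.2)

theorem sum_opts (a : Bool × Bool) (f : Bool × Bool → ℝ) :
    ((opts a).map f).sum = ∑ s, if within s a then f s else 0 := by
  rcases a with ⟨_ | _, _ | _⟩ <;> simp [opts, within, Fintype.sum_prod_type] <;> ring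

/-- The selections use available elements only and span no edge. -/
def allowed (a₀ a₁ a₂ : Bool × Bool) (e₀₁ e₀₂ e₁₂ : Edges) (s₀ s₁ s₂ : Bool × Bool) : Prop :=
  within s₀ a₀ ∧ within s₁ a₁ ∧ within s₂ a₂ ∧ ¬ hits e₀₁ s₀ s₁ ∧ ¬ hits e₀₂ s₀ s₂ ∧
    ¬ hits e₁₂ s₁ s₂

instance (a₀ a₁ a₂ : Bool × Bool) (e₀₁ e₀₂ e₁₂ : Edges) (s₀ s₁ s₂ : Bool × Bool) :
    Decidable (allowed a₀ a₁ a₂ e₀₁ e₀₂ e₁₂ s₀ s₁ s₂) := by unfold allowed; infer_instance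

theorem evalP_coefs (t : ℝ) (a₀ a₁ a₂ : Bool × Bool) (e₀₁ e₀₂ e₁₂ : Edges) :
    evalP t (coefs a₀ a₁ a₂ e₀₁ e₀₂ e₁₂) = ∑ s₀, ∑ s₁, ∑ s₂,
      if allowed a₀ a₁ a₂ e₀₁ e₀₂ e₁₂ s₀ s₁ s₂ then
        evalP t (weightTab (cnt s₀) (cnt s₁) (cnt s₂)) else 0 := by
  unfold coefs
  simp only [evalP_sumP, sum_opts]
  refine sum_congr rfl fun s₀ _ => ?_
  by_cases h0 : within s₀ a₀ = true
  swap
  · simp [allowed, h0]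
  rw [if_pos h0]
  refine sum_congr rfl fun s₁ _ => ?_
  by_cases h1 : within s₁ a₁ = true
  swap
  · simp [allowed, h1]
  rw [if_pos h1]
  by_cases h01 : hits e₀₁ s₀ s₁ = true
  · simp [allowed, h01, evalP]
  simp only [Bool.not_eq_true] at h01
  simp only [h01, cond_false, evalP_sumP, sum_opts]
  refine sum_congr rfl fun s₂ _ => ?_
  by_cases h2 : within s₂ a₂ = true
  swap
  · simp [allowed, h2]
  cases h02 : hits e₀₂ s₀ s₂ <;> cases h12 : hits e₁₂ s₁ s₂ <;>
    simp [allowed, h0, h1, h2, h01, h02, h12, evalP]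

theorem goodConfig_of_mem (a₀ a₁ a₂ : Bool × Bool) {e₀₁ e₀₂ e₁₂ : Edges}
    (h₀₁ : e₀₁ ∈ matchings a₀ a₁) (h₀₂ : e₀₂ ∈ matchings a₀ a₂) (h₁₂ : e₁₂ ∈ matchings a₁ a₂) :
    goodConfig a₀ a₁ a₂ e₀₁ e₀₂ e₁₂ (coefs a₀ a₁ a₂ e₀₁ e₀₂ e₁₂) = true := by
  have hmem : ∀ a : Bool × Bool, a ∈ boolPairs := by decide
  have h := goodConfig_all
  simp only [List.all_eq_true] at h
  exact h a₀ (hmem _) a₁ (hmem _) a₂ (hmem _) e₀₁ h₀₁ e₀₂ h₀₂ e₁₂ h₁₂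

/-- Removing the edges at unavailable elements. -/
def trim (a b : Bool × Bool) (e : Edges) : Edges :=
  ((e.1.1 && (a.1 && b.1), e.1.2 && (a.1 && b.2)), (e.2.1 && (a.2 && b.1), e.2.2 && (a.2 && b.2)))

/-- No two of the four edges share an end. -/
def IsPartialMatching (e : Edges) : Prop :=
  (e.1.1 && e.1.2) = false ∧ (e.2.1 && e.2.2) = false ∧
    (e.1.1 && e.2.1) = false ∧ (e.1.2 && e.2.2) = false

instance : DecidablePred IsPartialMatching := fun e => by unfold IsPartialMatching; infer_instance

theorem trim_mem_matchings : ∀ (a b : Bool × Bool) (e : Edges), IsPartialMatching e →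
    trim a b e ∈ matchings a b := by decide +kernel

theorem hits_trim : ∀ (a b : Bool × Bool) (e : Edges) (s r : Bool × Bool),
    within s a = true → within r b = true → hits (trim a b e) s r = hits e s r := by
  decide +kernel

theorem evalP_coefs_trim (t : ℝ) (a₀ a₁ a₂ : Bool × Bool) (e₀₁ e₀₂ e₁₂ : Edges) :
    evalP t (coefs a₀ a₁ a₂ (trim a₀ a₁ e₀₁) (trim a₀ a₂ e₀₂) (trim a₁ a₂ e₁₂)) =
      evalP t (coefs a₀ a₁ a₂ e₀₁ e₀₂ e₁₂) := by
  rw [evalP_coefs, evalP_coefs]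
  refine sum_congr rfl fun s₀ _ => sum_congr rfl fun s₁ _ => sum_congr rfl fun s₂ _ => ?_
  refine if_congr ?_ rfl rfl
  unfold allowed
  refine and_congr_right fun h0 => and_congr_right fun h1 => and_congr_right fun h2 => ?_
  rw [hits_trim _ _ _ _ _ h0 h1, hits_trim _ _ _ _ _ h0 h2, hits_trim _ _ _ _ _ h1 h2]

theorem evalP_coefs_nonneg {t : ℝ} (ht : 0 < t) (a₀ a₁ a₂ : Bool × Bool) {e₀₁ e₀₂ e₁₂ : Edges}
    (h₀₁ : IsPartialMatching e₀₁) (h₀₂ : IsPartialMatching e₀₂) (h₁₂ : IsPartialMatching e₁₂) :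
    0 ≤ evalP t (coefs a₀ a₁ a₂ e₀₁ e₀₂ e₁₂) := by
  rw [← evalP_coefs_trim]
  have h := goodConfig_of_mem a₀ a₁ a₂ (trim_mem_matchings a₀ a₁ _ h₀₁)
    (trim_mem_matchings a₀ a₂ _ h₀₂) (trim_mem_matchings a₁ a₂ _ h₁₂)
  rw [goodConfig, Bool.and_eq_true] at h
  exact evalP_nonneg ht h.1

theorem goodConfig_of_eq_zero {t : ℝ} (ht : 0 < t) {a₀ a₁ a₂ : Bool × Bool} {e₀₁ e₀₂ e₁₂ : Edges}
    (h₀₁ : IsPartialMatching e₀₁) (h₀₂ : IsPartialMatching e₀₂) (h₁₂ : IsPartialMatching e₁₂)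
    (h0 : evalP t (coefs a₀ a₁ a₂ e₀₁ e₀₂ e₁₂) = 0) :
    ((cnt a₀ = 2 ∧ cnt a₁ = 2 ∧ cnt a₂ = 2) →
      trim a₀ a₁ e₀₁ = noEdge ∧ trim a₀ a₂ e₀₂ = noEdge ∧ trim a₁ a₂ e₁₂ = noEdge) ∧
    ((trim a₀ a₁ e₀₁ = noEdge ∧ trim a₀ a₂ e₀₂ = noEdge ∧ trim a₁ a₂ e₁₂ = noEdge) →
      (cnt a₀ = 2 ∧ cnt a₁ = 2 ∧ cnt a₂ = 2) ∨ (cnt a₀ = 1 ∧ cnt a₁ = 1 ∧ cnt a₂ = 1) ∨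
        cnt a₀ + cnt a₁ + cnt a₂ ≤ 1) := by
  rw [← evalP_coefs_trim] at h0
  have h := goodConfig_of_mem a₀ a₁ a₂ (trim_mem_matchings a₀ a₁ _ h₀₁)
    (trim_mem_matchings a₀ a₂ _ h₀₂) (trim_mem_matchings a₁ a₂ _ h₁₂)
  rw [goodConfig, Bool.and_eq_true, Bool.or_eq_true] at h
  rcases h with ⟨h1, h2 | h2⟩
  · exact absurd h0 (evalP_pos ht h1 h2).ne'
  · simp only [Bool.and_eq_true, Bool.or_eq_true, Bool.not_eq_true', decide_eq_true_eq,
      decide_eq_false_iff_not] at h2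
    exact ⟨fun h => h2.1.resolve_left (not_not_intro h), fun h => h2.2.resolve_left (not_not_intro h)⟩

/-- A configuration of weight zero with all six second neighbours available has no edges. -/
theorem eq_noEdge_of_tight {t : ℝ} (ht : 0 < t) {e₀₁ e₀₂ e₁₂ : Edges}
    (h₀₁ : IsPartialMatching e₀₁) (h₀₂ : IsPartialMatching e₀₂) (h₁₂ : IsPartialMatching e₁₂)
    (h0 : evalP t (coefs (true, true) (true, true) (true, true) e₀₁ e₀₂ e₁₂) = 0) :
    e₀₁ = noEdge ∧ e₀₂ = noEdge ∧ e₁₂ = noEdge := by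
  simpa [trim] using (goodConfig_of_eq_zero ht h₀₁ h₀₂ h₁₂ h0).1 (by simp [cnt])

theorem cnt_eq_of_tight {t : ℝ} (ht : 0 < t) {a₀ a₁ a₂ : Bool × Bool}
    (h0 : evalP t (coefs a₀ a₁ a₂ noEdge noEdge noEdge) = 0) :
      (cnt a₀ = 2 ∧ cnt a₁ = 2 ∧ cnt a₂ = 2) ∨ (cnt a₀ = 1 ∧ cnt a₁ = 1 ∧ cnt a₂ = 1) ∨
        cnt a₀ + cnt a₁ + cnt a₂ ≤ 1 := by
  have hn : IsPartialMatching noEdge := by decide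
  exact (goodConfig_of_eq_zero ht hn hn hn h0).2 (by simp [trim, noEdge])

/-- The availability patterns of the Heawood graph have weight zero: `p`, `q`, `r`, `s` tell which of
the four vertices at distance three from the root are occupied, and each second neighbour is joined
to two of these. -/
theorem evalP_coefs_heawood (t : ℝ) (p q r s : Bool) :
    evalP t (coefs (!(p || q), !(r || s)) (!(p || r), !(q || s)) (!(p || s), !(q || r))
      noEdge noEdge noEdge) = 0 := by
  have h : ∀ p q r s : Bool, ((coefs (!(p || q), !(r || s)) (!(p || r), !(q || s))
      (!(p || s), !(q || r)) noEdge noEdge noEdge).all fun c => decide (c = 0)) = true := by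
    decide +kernel
  exact evalP_eq_zero t (h p q r s)

/-! ### The slack of a vertex as a sum over distant sets -/

section LocalSum

variable {V : Type*}

/-- No cycles of length three or four: no triangle, and no two vertices with two common neighbours. -/
structure GirthFive (G : SimpleGraph V) : Prop where
  no_triangle : ∀ {a b c}, G.Adj a b → G.Adj b c → ¬ G.Adj a c
  no_square : ∀ {a b x y}, a ≠ b → G.Adj a x → G.Adj b x → G.Adj a y → G.Adj b y → x = y

/-- A labelling of the ball of radius two about `v` in a cubic graph: neighbours `u i`, and for each
`i` two further neighbours `w i b` of `u i`, all distinct. The vertices `w i false`, `w i true` form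
the branch `i`. -/
structure Labelling (G : SimpleGraph V) (v : V) where
  u : Fin 3 → V
  w : Fin 3 → Bool → V
  adj_root : ∀ z, G.Adj v z ↔ ∃ i, u i = z
  adj_u : ∀ i z, G.Adj (u i) z ↔ z = v ∨ ∃ b, w i b = z
  u_inj : Function.Injective u
  w_inj : ∀ {i j b c}, w i b = w j c → i = j ∧ b = c
  w_ne_root : ∀ i b, w i b ≠ v
  w_ne_u : ∀ i b j, w i b ≠ u j

variable [Fintype V] [DecidableEq V] (G : SimpleGraph V) [DecidableRel G.Adj]

/-- Independence of a finset in a form that allows equal elements and is decidable. -/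
def Ind (I : Finset V) : Prop := ∀ x ∈ I, ∀ y ∈ I, ¬ G.Adj x y

instance : DecidablePred (Ind G) := fun I => by unfold Ind; infer_instance

theorem mem_indepSets {I : Finset V} : I ∈ indepSets G ↔ Ind G I := by
  simp only [indepSets, mem_filter, mem_univ, true_and, SimpleGraph.IsIndepSet, Set.Pairwise, Ind,
    mem_coe]
  constructor
  · intro h x hx y hy hxy
    exact h hx hy hxy.ne hxy
  · intro h x hx y hy _
    exact h x hx y hy

/-- The number of neighbours of `x` in `I`. -/
def occ (I : Finset V) (x : V) : ℕ := (G.neighborFinset x ∩ I).card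

/-- The dual objective at `v` for the independent set `I`, scaled by `3 * occDen t`. -/
noncomputable def charge (t : ℝ) (I : Finset V) (v : V) : ℝ :=
  3 * occNum t - 3 * occDen t * (if v ∈ I then 1 else 0) - 3 * multiplier t (occ G I v) +
    ∑ u ∈ G.neighborFinset v, multiplier t (occ G I u)

/-- The charge at `v` summed over all independent sets with their hard-core weights. -/
noncomputable def slack (t : ℝ) (v : V) : ℝ :=
  ∑ I ∈ indepSets G, t ^ I.card * charge G t I v

omit [Fintype V] in
theorem sum_powerset_union {A B : Finset V} (h : Disjoint A B) (g : Finset V → ℝ) :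
    ∑ I ∈ (A ∪ B).powerset, g I = ∑ T ∈ A.powerset, ∑ S ∈ B.powerset, g (T ∪ S) := by
  rw [← sum_product']
  symm
  refine sum_bij' (fun p _ => p.1 ∪ p.2) (fun I _ => (I ∩ A, I ∩ B)) ?_ ?_ ?_ ?_ ?_
  · intro p hp
    simp only [mem_product, mem_powerset] at hp ⊢
    exact union_subset_union hp.1 hp.2
  · intro I _
    simp
  · rintro ⟨T, S⟩ hp
    simp only [mem_product, mem_powerset] at hp
    have h1 : S ∩ A = ∅ := disjoint_iff_inter_eq_empty.1 (disjoint_of_subset_left hp.2 h.symm)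
    have h2 : T ∩ B = ∅ := disjoint_iff_inter_eq_empty.1 (disjoint_of_subset_left hp.1 h)
    simp [union_inter_distrib_right, h1, h2, inter_eq_left.2 hp.1, inter_eq_left.2 hp.2]
  · intro I hI
    simp only [mem_powerset] at hI
    rw [← inter_union_distrib_left, inter_eq_left.2 hI]
  · intros; rfl

variable {G}

theorem occ_eq_zero_iff {I : Finset V} {x : V} : occ G I x = 0 ↔ ∀ y ∈ I, ¬ G.Adj x y := by
  rw [occ, card_eq_zero, eq_empty_iff_forall_notMem]
  simp only [mem_inter, SimpleGraph.mem_neighborFinset]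
  exact ⟨fun h y hy hxy => h y ⟨hxy, hy⟩, fun h y hy => h y hy.2 hy.1⟩

/-- Summation over the occupation of the closed neighbourhood of `v`, given the rest `T`. -/
theorem sum_near (hG : GirthFive G) (t : ℝ) (v : V) {T : Finset V}
    (hT : T ⊆ (insert v (G.neighborFinset v))ᶜ) :
    (∑ S ∈ (insert v (G.neighborFinset v)).powerset,
      if Ind G (T ∪ S) then t ^ (T ∪ S).card * charge G t (T ∪ S) v else 0) =
    if Ind G T then t ^ T.card * localWeight t (G.neighborFinset v) (occ G T) else 0 := by
  by_cases hI : Ind G T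
  swap
  · rw [if_neg hI]
    refine sum_eq_zero fun S _ => if_neg fun h => hI ?_
    exact fun x hx y hy => h x (mem_union_left _ hx) y (mem_union_left _ hy)
  have hvT : v ∉ T := fun h => by simpa using hT h
  have hNT : ∀ x ∈ T, ¬ G.Adj v x := fun x h h' => by simpa [h'] using hT h
  have hvN : v ∉ G.neighborFinset v := by simp
  rw [if_pos hI, sum_powerset_insert hvN, localWeight, mul_add, add_comm]
  congr 1
  · -- Once the root is occupied, none of its neighbours can be.
    rw [sum_eq_single_of_mem ∅ (empty_mem_powerset _)]
    · have h1 : T ∪ insert v ∅ = insert v T := by ext; simp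
      have hind : Ind G (insert v T) := by
        intro x hx y hy hxy
        rcases mem_insert.1 hx with hx' | hx' <;> rcases mem_insert.1 hy with hy' | hy'
        · exact G.irrefl (hx' ▸ hy' ▸ hxy)
        · exact hNT _ hy' (hx' ▸ hxy)
        · exact hNT _ hx' (hy' ▸ hxy.symm)
        · exact hI _ hx' _ hy' hxy
      have h0 : occ G (insert v T) v = 0 := by
        rw [occ_eq_zero_iff]
        exact fun y hy hvy => hind v (mem_insert_self _ _) y hy hvy
      rw [h1, if_pos hind, card_insert_of_notMem hvT, charge, if_pos (mem_insert_self _ _), h0]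
      have h2 : ∀ u ∈ G.neighborFinset v, occ G (insert v T) u = occ G T u + 1 := by
        intro u hu
        rw [occ, occ, inter_insert_of_mem (by simpa [SimpleGraph.adj_comm] using hu),
          card_insert_of_notMem (by simp [hvT])]
      rw [sum_congr rfl fun u hu => by rw [h2 u hu]]
      simp only [multiplier]
      ring
    · intro U hU hne
      obtain ⟨x, hx⟩ := nonempty_iff_ne_empty.2 hne
      refine if_neg fun h => h v (by simp) x (by simp [hx]) ?_
      simpa using mem_powerset.1 hU hx
  · have hiff : ∀ U ∈ (G.neighborFinset v).powerset,
        Ind G (T ∪ U) ↔ U ⊆ (G.neighborFinset v).filter fun u => occ G T u = 0 := by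
      intro U hU
      rw [mem_powerset] at hU
      constructor
      · intro h x hx
        rw [mem_filter, occ_eq_zero_iff]
        exact ⟨hU hx, fun y hy => h x (mem_union_right _ hx) y (mem_union_left _ hy)⟩
      · intro h x hx y hy hxy
        rcases mem_union.1 hx with hx | hx <;> rcases mem_union.1 hy with hy | hy
        · exact hI _ hx _ hy hxy
        · exact occ_eq_zero_iff.1 (mem_filter.1 (h hy)).2 _ hx hxy.symm
        · exact occ_eq_zero_iff.1 (mem_filter.1 (h hx)).2 _ hy hxy
        · have hx' := hU hx
          have hy' := hU hy
          simp only [SimpleGraph.mem_neighborFinset] at hx' hy'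
          exact hG.no_triangle hx' hxy hy'
    rw [mul_sum, ← sum_subset (powerset_mono.2 (filter_subset (fun u => occ G T u = 0) _)) ?_]
    · refine sum_congr rfl fun U hU => ?_
      have hUN := (mem_powerset.1 hU).trans (filter_subset _ _)
      rw [if_pos ((hiff U (mem_powerset.2 hUN)).2 (mem_powerset.1 hU)), charge, if_neg, mul_zero,
        sub_zero]
      · have hdis : Disjoint T U := by
          refine disjoint_left.2 fun x hx hxU => hNT x hx ?_
          simpa using hUN hxU
        have h1 : occ G (T ∪ U) v = U.card := by
          rw [occ]
          congr 1
          ext x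
          simp only [mem_inter, SimpleGraph.mem_neighborFinset, mem_union]
          constructor
          · rintro ⟨h, h' | h'⟩
            · exact absurd h (hNT x h')
            · exact h'
          · exact fun h => ⟨by simpa using hUN h, Or.inr h⟩
        have h2 : ∀ u ∈ G.neighborFinset v, occ G (T ∪ U) u = occ G T u := by
          intro u hu
          rw [occ, occ]
          congr 1
          ext x
          simp only [mem_inter, SimpleGraph.mem_neighborFinset, mem_union]
          constructor
          · rintro ⟨h, h' | h'⟩
            · exact ⟨h, h'⟩
            · exact absurd (by simpa using hUN h') (hG.no_triangle (by simpa using hu) h)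
          · exact fun h => ⟨h.1, Or.inl h.2⟩
        rw [card_union_of_disjoint hdis, h1, sum_congr rfl fun u hu => by rw [h2 u hu], pow_add]
        ring
      · simp only [mem_union, not_or]
        exact ⟨hvT, fun h => hvN (hUN h)⟩
    · intro U hU hU'
      rw [if_neg]
      rw [hiff U hU]
      simpa using hU'

theorem slack_eq_sum_far (hG : GirthFive G) (t : ℝ) (v : V) :
    slack G t v = ∑ T ∈ ((insert v (G.neighborFinset v))ᶜ).powerset,
      if Ind G T then t ^ T.card * localWeight t (G.neighborFinset v) (occ G T) else 0 := by
  have h : indepSets G = univ.filter (Ind G) := by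
    ext I; simp [mem_indepSets]
  have hu : (univ : Finset V) =
      (insert v (G.neighborFinset v))ᶜ ∪ insert v (G.neighborFinset v) := by
    rw [union_comm, union_compl]
  rw [slack, h, sum_filter, ← powerset_univ, hu,
    sum_powerset_union disjoint_compl_left]
  exact sum_congr rfl fun T hT => sum_near hG t v (mem_powerset.1 hT)

theorem sum_fin_three_fun {α : Type*} [Fintype α] (f : (Fin 3 → α) → ℝ) :
    ∑ s, f s = ∑ a, ∑ b, ∑ c, f ![a, b, c] := by
  let e : (Fin 3 → α) ≃ α × α × α :=
    { toFun := fun s => (s 0, s 1, s 2)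
      invFun := fun p => ![p.1, p.2.1, p.2.2]
      left_inv := fun s => by ext i; fin_cases i <;> rfl
      right_inv := fun p => rfl }
  rw [← e.symm.sum_comp f, Fintype.sum_prod_type]
  simp only [Fintype.sum_prod_type]
  rfl

/-- The element of a pair of Booleans at a Boolean position, `false` being the first. -/
def selects (s : Bool × Bool) (b : Bool) : Bool := bif b then s.2 else s.1

namespace Labelling

variable {v : V} (l : Labelling G v)

/-- The second neighbours of the root. -/
def second : Finset V := univ.image fun p : Fin 3 × Bool => l.w p.1 p.2

/-- The vertices at distance at least three from the root. -/
def outer (l : Labelling G v) : Finset V := (insert v (G.neighborFinset v))ᶜ \ l.second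

/-- The set of second neighbours selected by a pair of Booleans for each branch. -/
def sel (s : Fin 3 → Bool × Bool) : Finset V :=
  (univ.filter fun p : Fin 3 × Bool => selects (s p.1) p.2 = true).image fun p => l.w p.1 p.2

theorem mem_sel {s : Fin 3 → Bool × Bool} {x : V} :
    x ∈ l.sel s ↔ ∃ i b, selects (s i) b = true ∧ l.w i b = x := by
  simp [sel]

theorem w_mem_sel {s : Fin 3 → Bool × Bool} {i : Fin 3} {b : Bool} :
    l.w i b ∈ l.sel s ↔ selects (s i) b = true := by
  rw [mem_sel]
  constructor
  · rintro ⟨j, c, h, h'⟩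
    obtain ⟨rfl, rfl⟩ := l.w_inj h'
    exact h
  · exact fun h => ⟨i, b, h, rfl⟩

theorem mem_second {x : V} : x ∈ l.second ↔ ∃ i b, l.w i b = x := by simp [second]

theorem mem_outer {x : V} : x ∈ l.outer ↔
    x ≠ v ∧ (∀ i, l.u i ≠ x) ∧ ∀ i b, l.w i b ≠ x := by
  simp only [outer, mem_sdiff, mem_compl, mem_insert, SimpleGraph.mem_neighborFinset, l.adj_root,
    l.mem_second]
  push Not
  tauto

theorem neighborFinset_root : G.neighborFinset v = univ.image l.u := by
  ext x; simp [l.adj_root]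

theorem sum_powerset_second (g : Finset V → ℝ) :
    ∑ K ∈ l.second.powerset, g K = ∑ s, g (l.sel s) := by
  symm
  refine sum_bij' (fun s _ => l.sel s)
    (fun K _ => fun i => (decide (l.w i false ∈ K), decide (l.w i true ∈ K))) ?_ ?_ ?_ ?_ ?_
  · intro s _
    rw [mem_powerset]
    intro x hx
    obtain ⟨i, b, -, h⟩ := l.mem_sel.1 hx
    exact l.mem_second.2 ⟨i, b, h⟩
  · simp
  · intro s _
    ext i <;> simp [w_mem_sel, selects]
  · intro K hK
    ext x
    rw [mem_sel]
    constructor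
    · rintro ⟨i, b, h, rfl⟩
      cases b <;> simpa [selects] using h
    · intro hx
      obtain ⟨i, b, rfl⟩ := l.mem_second.1 (mem_powerset.1 hK hx)
      refine ⟨i, b, ?_, rfl⟩
      cases b <;> simpa [selects] using hx
  · intros; rfl

/-- The second neighbours behind `u i` with no neighbour in `J`. -/
def avail (J : Finset V) (i : Fin 3) : Bool × Bool :=
  (decide (∀ x ∈ J, ¬ G.Adj x (l.w i false)), decide (∀ x ∈ J, ¬ G.Adj x (l.w i true)))

/-- The edges between the second neighbours behind `u i` and those behind `u j`. -/
def edges (i j : Fin 3) : Edges :=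
  ((decide (G.Adj (l.w i false) (l.w j false)), decide (G.Adj (l.w i false) (l.w j true))),
    (decide (G.Adj (l.w i true) (l.w j false)), decide (G.Adj (l.w i true) (l.w j true))))

theorem selects_avail {J : Finset V} {i : Fin 3} {b : Bool} :
    selects (l.avail J i) b = true ↔ ∀ x ∈ J, ¬ G.Adj x (l.w i b) := by
  cases b <;> simp [selects, avail]

theorem within_iff {s a : Bool × Bool} :
    within s a = true ↔ ∀ b, selects s b = true → selects a b = true := by
  revert s a; decide

theorem not_hits_edges {i j : Fin 3} {s r : Bool × Bool} :
    (¬ hits (l.edges i j) s r = true) ↔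
      ∀ b c, selects s b = true → selects r c = true → ¬ G.Adj (l.w i b) (l.w j c) := by
  rcases s with ⟨_ | _, _ | _⟩ <;> rcases r with ⟨_ | _, _ | _⟩ <;>
    (simp [hits, edges, selects]; try tauto)

theorem not_adj_siblings (hG : GirthFive G) (i : Fin 3) (b c : Bool) :
    ¬ G.Adj (l.w i b) (l.w i c) := fun h =>
  hG.no_triangle ((l.adj_u i _).2 (Or.inr ⟨b, rfl⟩)) h ((l.adj_u i _).2 (Or.inr ⟨c, rfl⟩))

theorem ind_union_sel (hG : GirthFive G) {J : Finset V} {s : Fin 3 → Bool × Bool} :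
    Ind G (J ∪ l.sel s) ↔ Ind G J ∧ allowed (l.avail J 0) (l.avail J 1) (l.avail J 2)
      (l.edges 0 1) (l.edges 0 2) (l.edges 1 2) (s 0) (s 1) (s 2) := by
  simp only [allowed, within_iff, not_hits_edges, selects_avail]
  constructor
  · intro h
    have hw : ∀ i b, selects (s i) b = true → l.w i b ∈ J ∪ l.sel s := fun i b hb =>
      mem_union_right _ (l.w_mem_sel.2 hb)
    have hJ : ∀ x ∈ J, x ∈ J ∪ l.sel s := fun x hx => mem_union_left _ hx
    exact ⟨fun x hx y hy => h x (hJ x hx) y (hJ y hy),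
      fun b hb x hx => h x (hJ x hx) _ (hw 0 b hb), fun b hb x hx => h x (hJ x hx) _ (hw 1 b hb),
      fun b hb x hx => h x (hJ x hx) _ (hw 2 b hb), fun b c hb hc => h _ (hw _ _ hb) _ (hw _ _ hc),
      fun b c hb hc => h _ (hw _ _ hb) _ (hw _ _ hc),
      fun b c hb hc => h _ (hw _ _ hb) _ (hw _ _ hc)⟩
  · rintro ⟨hJ, h0, h1, h2, h01, h02, h12⟩
    have hw : ∀ i b, selects (s i) b = true → ∀ x ∈ J, ¬ G.Adj x (l.w i b) := by
      intro i b; fin_cases i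
      exacts [h0 b, h1 b, h2 b]
    have hww : ∀ i j b c, selects (s i) b = true → selects (s j) c = true →
        ¬ G.Adj (l.w i b) (l.w j c) := by
      intro i j b c hb hc
      fin_cases i <;> fin_cases j
      exacts [l.not_adj_siblings hG _ _ _, h01 b c hb hc, h02 b c hb hc,
        fun h => h01 c b hc hb h.symm, l.not_adj_siblings hG _ _ _, h12 b c hb hc,
        fun h => h02 c b hc hb h.symm, fun h => h12 c b hc hb h.symm,
        l.not_adj_siblings hG _ _ _]
    intro x hx y hy hxy
    rcases mem_union.1 hx with hx | hx <;> rcases mem_union.1 hy with hy | hy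
    · exact hJ x hx y hy hxy
    · obtain ⟨i, b, hb, rfl⟩ := l.mem_sel.1 hy
      exact hw i b hb x hx hxy
    · obtain ⟨i, b, hb, rfl⟩ := l.mem_sel.1 hx
      exact hw i b hb y hy hxy.symm
    · obtain ⟨i, b, hb, rfl⟩ := l.mem_sel.1 hx
      obtain ⟨j, c, hc, rfl⟩ := l.mem_sel.1 hy
      exact hww i j b c hb hc hxy

theorem card_filter_selects (s : Bool × Bool) :
    (univ.filter fun b : Bool => selects s b = true).card = cnt s := by revert s; decide

theorem card_sel (s : Fin 3 → Bool × Bool) :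
    (l.sel s).card = cnt (s 0) + cnt (s 1) + cnt (s 2) := by
  rw [sel, card_image_of_injective, card_filter, Fintype.sum_prod_type]
  · simp only [← card_filter, card_filter_selects, Fin.sum_univ_three]
  · rintro ⟨i, b⟩ ⟨j, c⟩ h
    obtain ⟨rfl, rfl⟩ := l.w_inj h
    rfl

theorem occ_union_sel {J : Finset V} (hJ : J ⊆ l.outer) (s : Fin 3 → Bool × Bool) (i : Fin 3) :
    occ G (J ∪ l.sel s) (l.u i) = cnt (s i) := by
  have h : G.neighborFinset (l.u i) ∩ (J ∪ l.sel s) =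
      (univ.filter fun b : Bool => selects (s i) b = true).image (l.w i) := by
    ext x
    simp only [mem_inter, SimpleGraph.mem_neighborFinset, l.adj_u, mem_union, mem_image, mem_filter,
      mem_univ, true_and]
    constructor
    · rintro ⟨rfl | ⟨b, rfl⟩, hx | hx⟩
      · exact absurd rfl (l.mem_outer.1 (hJ hx)).1
      · obtain ⟨j, c, -, h⟩ := l.mem_sel.1 hx
        exact absurd h (l.w_ne_root _ _)
      · exact absurd rfl ((l.mem_outer.1 (hJ hx)).2.2 i b)
      · exact ⟨b, l.w_mem_sel.1 hx, rfl⟩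
    · rintro ⟨b, hb, rfl⟩
      exact ⟨Or.inr ⟨b, rfl⟩, Or.inr (l.w_mem_sel.2 hb)⟩
  rw [occ, h, card_image_of_injective _ fun b c h => (l.w_inj h).2, card_filter_selects]

theorem cnt_le (s : Bool × Bool) : cnt s ≤ 2 := by revert s; decide

/-- The polynomial weight, evaluated at `t`, of the configuration that a set `J` of vertices at
distance at least three induces on the second neighbours. -/
noncomputable def farWeight (t : ℝ) (J : Finset V) : ℝ :=
  evalP t (coefs (l.avail J 0) (l.avail J 1) (l.avail J 2)
    (l.edges 0 1) (l.edges 0 2) (l.edges 1 2))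

/-- Summation over the occupation of the ball of radius two, given the rest `J`. -/
theorem sum_second (hG : GirthFive G) (t : ℝ) {J : Finset V} (hJ : J ⊆ l.outer) :
    (∑ K ∈ l.second.powerset, if Ind G (J ∪ K) then
      t ^ (J ∪ K).card * localWeight t (G.neighborFinset v) (occ G (J ∪ K)) else 0) =
    if Ind G J then t ^ J.card * (t ^ 5 * l.farWeight t J) else 0 := by
  rw [sum_powerset_second]
  by_cases hI : Ind G J
  swap
  · rw [if_neg hI]
    exact sum_eq_zero fun s _ => if_neg fun h => hI ((l.ind_union_sel hG).1 h).1
  rw [if_pos hI, farWeight, evalP_coefs, mul_sum, mul_sum, sum_fin_three_fun]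
  refine sum_congr rfl fun s₀ _ => ?_
  rw [mul_sum, mul_sum]
  refine sum_congr rfl fun s₁ _ => ?_
  rw [mul_sum, mul_sum]
  refine sum_congr rfl fun s₂ _ => ?_
  by_cases hA : allowed (l.avail J 0) (l.avail J 1) (l.avail J 2)
      (l.edges 0 1) (l.edges 0 2) (l.edges 1 2) s₀ s₁ s₂
  · have hdis : Disjoint J (l.sel ![s₀, s₁, s₂]) := by
      refine disjoint_left.2 fun x hx hx' => ?_
      obtain ⟨i, b, -, h⟩ := l.mem_sel.1 hx'
      exact (l.mem_outer.1 (hJ hx)).2.2 i b h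
    rw [if_pos hA, if_pos ((l.ind_union_sel hG).2 ⟨hI, hA⟩), card_union_of_disjoint hdis,
      card_sel, pow_add, l.neighborFinset_root, mul_assoc]
    have hocc := l.occ_union_sel hJ ![s₀, s₁, s₂]
    have := pow_mul_localWeight t l.u_inj (occ G (J ∪ l.sel ![s₀, s₁, s₂]))
      fun i => (hocc i).trans_le (cnt_le _)
    simp only [hocc] at this
    rw [this]
    rfl
  · rw [if_neg hA, if_neg fun h => hA ((l.ind_union_sel hG).1 h).2]
    simp

theorem slack_eq (hG : GirthFive G) (t : ℝ) :
    slack G t v = t ^ 5 * ∑ J ∈ l.outer.powerset.filter (Ind G), t ^ J.card * l.farWeight t J := by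
  have hsub : l.second ⊆ (insert v (G.neighborFinset v))ᶜ := by
    intro x hx
    obtain ⟨i, b, rfl⟩ := l.mem_second.1 hx
    simp only [mem_compl, mem_insert, SimpleGraph.mem_neighborFinset, l.adj_root, not_or]
    exact ⟨l.w_ne_root i b, fun ⟨j, h⟩ => l.w_ne_u i b j h.symm⟩
  rw [slack_eq_sum_far hG, ← sdiff_union_of_subset hsub, sum_powerset_union disjoint_sdiff_self_left,
    sum_filter, mul_sum]
  refine sum_congr rfl fun J hJ => ?_
  rw [l.sum_second hG t (mem_powerset.1 hJ)]
  split_ifs <;> ring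

end Labelling

end LocalSum

/-! ### Nonnegativity of the slack and the forced local structure -/

section Rigidity

variable {V : Type*}

theorem girthFive_of_egirth {G : SimpleGraph V} (h : 5 ≤ G.egirth) : GirthFive G := by
  rw [SimpleGraph.le_egirth] at h
  constructor
  · intro a b c hab hbc hac
    have hc : (SimpleGraph.Walk.cons hab (.cons hbc (.cons hac.symm .nil))).IsCycle := by
      rw [SimpleGraph.Walk.cons_isCycle_iff]
      simp [hab.ne, hbc.ne, hac.ne, hac.ne', hab.ne']
    have := h a _ hc
    norm_num at this
  · intro a b x y hab hax hbx hay hby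
    by_contra hxy
    have hc : (SimpleGraph.Walk.cons hax
        (.cons hbx.symm (.cons hby (.cons hay.symm .nil)))).IsCycle := by
      rw [SimpleGraph.Walk.cons_isCycle_iff]
      simp [hab, hxy, hax.ne, hay.ne, hby.ne, hax.ne', hbx.ne', hay.ne', Ne.symm hab]
    have := h a _ hc
    norm_num at this

theorem exists_enumeration {κ : Type*} [Fintype κ] (s : Finset V) (h : s.card = Fintype.card κ) :
    ∃ f : κ → V, Function.Injective f ∧ ∀ z, z ∈ s ↔ ∃ i, f i = z := by
  have e : κ ≃ s := Fintype.equivOfCardEq (by simp [h])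
  refine ⟨fun i => (e i : V), fun i j hij => e.injective (Subtype.ext hij), fun z => ⟨fun hz => ?_, ?_⟩⟩
  · exact ⟨e.symm ⟨z, hz⟩, by simp⟩
  · rintro ⟨i, rfl⟩
    exact (e i).2

variable [Fintype V] [DecidableEq V] {G : SimpleGraph V} [DecidableRel G.Adj]

theorem exists_labelling (hG : GirthFive G) (hreg : G.IsRegularOfDegree 3) (v : V) :
    Nonempty (Labelling G v) := by
  obtain ⟨u, hu, hu'⟩ := exists_enumeration (κ := Fin 3) (G.neighborFinset v) (by simpa using hreg v)
  simp only [SimpleGraph.mem_neighborFinset] at hu'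
  have hvu : ∀ i, G.Adj (u i) v := fun i => ((hu' _).2 ⟨i, rfl⟩).symm
  have hw : ∀ i, ∃ f : Bool → V, Function.Injective f ∧
      ∀ z, z ∈ (G.neighborFinset (u i)).erase v ↔ ∃ b, f b = z := by
    intro i
    refine exists_enumeration _ ?_
    rw [card_erase_of_mem (by simpa using hvu i), SimpleGraph.card_neighborFinset_eq_degree,
      hreg (u i)]
    simp
  choose w hw1 hw2 using hw
  simp only [mem_erase, SimpleGraph.mem_neighborFinset] at hw2
  have hwne : ∀ i b, w i b ≠ v := fun i b => ((hw2 i _).2 ⟨b, rfl⟩).1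
  have hwadj : ∀ i b, G.Adj (u i) (w i b) := fun i b => ((hw2 i _).2 ⟨b, rfl⟩).2
  refine ⟨⟨u, w, hu', ?_, hu, ?_, hwne, ?_⟩⟩
  · intro i z
    rw [← hw2]
    by_cases hz : z = v
    · simp [hz, hvu]
    · simp [hz]
  · intro i j b c h
    have hij : i = j := by
      by_contra hij
      exact hwne i b (hG.no_square (hu.ne hij) (hwadj i b) (h ▸ hwadj j c) (hvu i) (hvu j))
    subst hij
    exact ⟨rfl, hw1 i h⟩
  · intro i b j h
    exact hG.no_triangle (hvu i).symm (hwadj i b) (h ▸ (hvu j).symm)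

namespace Labelling

variable {v : V} (l : Labelling G v)

theorem adj_u_w (i : Fin 3) (b : Bool) : G.Adj (l.u i) (l.w i b) :=
  (l.adj_u i _).2 (Or.inr ⟨b, rfl⟩)

theorem adj_u_root (i : Fin 3) : G.Adj (l.u i) v := (l.adj_u i _).2 (Or.inl rfl)

theorem isPartialMatching_edges (hG : GirthFive G) (i j : Fin 3) :
    IsPartialMatching (l.edges i j) := by
  have h1 : ∀ b, ¬ (G.Adj (l.w i b) (l.w j false) ∧ G.Adj (l.w i b) (l.w j true)) := fun b h =>
    Bool.false_ne_true (l.w_inj (hG.no_square (l.w_ne_u i b j).symm (l.adj_u_w j false) h.1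
      (l.adj_u_w j true) h.2)).2
  have h2 : ∀ b, ¬ (G.Adj (l.w i false) (l.w j b) ∧ G.Adj (l.w i true) (l.w j b)) := fun b h =>
    Bool.false_ne_true (l.w_inj (hG.no_square (l.w_ne_u j b i).symm (l.adj_u_w i false) h.1.symm
      (l.adj_u_w i true) h.2.symm)).2
  simp only [IsPartialMatching, edges, ← Bool.decide_and, decide_eq_false_iff_not]
  exact ⟨h1 _, h1 _, h2 _, h2 _⟩

theorem farWeight_nonneg (hG : GirthFive G) {t : ℝ} (ht : 0 < t) (J : Finset V) :
    0 ≤ l.farWeight t J :=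
  evalP_coefs_nonneg ht _ _ _ (l.isPartialMatching_edges hG _ _) (l.isPartialMatching_edges hG _ _)
    (l.isPartialMatching_edges hG _ _)

theorem farWeight_eq_zero (hG : GirthFive G) {t : ℝ} (ht : 0 < t) (h : slack G t v = 0)
    {J : Finset V} (hJ : J ⊆ l.outer) (hI : Ind G J) : l.farWeight t J = 0 := by
  rw [l.slack_eq hG, mul_eq_zero, or_iff_right (by positivity), sum_eq_zero_iff_of_nonneg] at h
  · have := h J (by simp [hJ, hI])
    exact (mul_eq_zero.1 this).resolve_left (by positivity)
  · intro J _
    have := l.farWeight_nonneg hG ht J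
    positivity

theorem not_adj_of_edges_eq {i j : Fin 3} (h : l.edges i j = noEdge) (b c : Bool) :
    ¬ G.Adj (l.w i b) (l.w j c) := by
  simp only [edges, noEdge, Prod.mk.injEq, decide_eq_false_iff_not] at h
  cases b <;> cases c
  exacts [h.1.1, h.1.2, h.2.1, h.2.2]

theorem edges_eq_noEdge (hG : GirthFive G) {t : ℝ} (ht : 0 < t) (h : slack G t v = 0) :
    l.edges 0 1 = noEdge ∧ l.edges 0 2 = noEdge ∧ l.edges 1 2 = noEdge := by
  have h0 := l.farWeight_eq_zero hG ht h (empty_subset _) (by simp [Ind])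
  refine eq_noEdge_of_tight ht (l.isPartialMatching_edges hG _ _)
    (l.isPartialMatching_edges hG _ _) (l.isPartialMatching_edges hG _ _) ?_
  simpa [farWeight, avail] using h0

theorem not_adj_w (hG : GirthFive G) {t : ℝ} (ht : 0 < t) (h : slack G t v = 0)
    (i j : Fin 3) (b c : Bool) : ¬ G.Adj (l.w i b) (l.w j c) := by
  obtain ⟨h1, h2, h3⟩ := l.edges_eq_noEdge hG ht h
  fin_cases i <;> fin_cases j
  exacts [l.not_adj_siblings hG _ _ _, l.not_adj_of_edges_eq h1 _ _, l.not_adj_of_edges_eq h2 _ _,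
    fun h => l.not_adj_of_edges_eq h1 _ _ h.symm, l.not_adj_siblings hG _ _ _,
    l.not_adj_of_edges_eq h3 _ _, fun h => l.not_adj_of_edges_eq h2 _ _ h.symm,
    fun h => l.not_adj_of_edges_eq h3 _ _ h.symm, l.not_adj_siblings hG _ _ _]

theorem eq_of_adj_w (hG : GirthFive G) {x : V} {i : Fin 3} {b c : Bool} (hx : l.u i ≠ x)
    (hb : G.Adj x (l.w i b)) (hc : G.Adj x (l.w i c)) : b = c :=
  (l.w_inj (hG.no_square hx (l.adj_u_w i b) hb (l.adj_u_w i c) hc)).2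

/-- At a vertex of slack zero, every vertex at distance three is joined to every branch: the set
`{x}` leaves an element available in each branch, so of the patterns of weight zero only one
available element per branch remains. -/
theorem exists_adj_w (hG : GirthFive G) {t : ℝ} (ht : 0 < t) (h : slack G t v = 0) {x : V}
    (hx : x ∈ l.outer) {i : Fin 3} {b : Bool} (hb : G.Adj x (l.w i b)) (j : Fin 3) :
    ∃ c, G.Adj x (l.w j c) := by
  have h0 := l.farWeight_eq_zero hG ht h (singleton_subset_iff.2 hx) (by simp [Ind])
  obtain ⟨h1, h2, h3⟩ := l.edges_eq_noEdge hG ht h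
  rw [farWeight, h1, h2, h3] at h0
  have hav : ∀ k, l.avail {x} k =
      (decide (¬ G.Adj x (l.w k false)), decide (¬ G.Adj x (l.w k true))) := by
    intro k; simp [avail]
  have hlow : ∀ k, 1 ≤ cnt (l.avail {x} k) := by
    intro k
    have := l.eq_of_adj_w hG (i := k) (b := false) (c := true) ((l.mem_outer.1 hx).2.1 k)
    rw [hav]
    by_cases h4 : G.Adj x (l.w k false) <;> by_cases h5 : G.Adj x (l.w k true) <;>
      simp_all [cnt]
  have hne : cnt (l.avail {x} i) ≠ 2 := by
    rw [hav]
    cases b <;> simp [hb, cnt] <;> exact ((Bool.toNat_le _).trans_lt (by norm_num)).ne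
  have key := cnt_eq_of_tight ht h0
  have h0' := hlow 0
  have h1' := hlow 1
  have h2' := hlow 2
  have hcnt : cnt (l.avail {x} j) = 1 := by
    have : ∀ k : Fin 3, k = 0 ∨ k = 1 ∨ k = 2 := by decide
    rcases this i with rfl | rfl | rfl <;> rcases this j with rfl | rfl | rfl <;> omega
  by_contra hcon
  push Not at hcon
  rw [hav] at hcnt
  simp [hcon, cnt] at hcnt

end Labelling

end Rigidity

/-! ### Recognising the Heawood graph around a vertex -/

section Embedding

variable {V : Type*} [Fintype V] [DecidableEq V] {G : SimpleGraph V} [DecidableRel G.Adj]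

theorem card_neighborFinset_heawood (a : ZMod 7 ⊕ ZMod 7) :
    (heawood.neighborFinset a).card = 3 := by
  revert a; decide +kernel

theorem heawood_isRegular : heawood.IsRegularOfDegree 3 := fun a => by
  rw [← SimpleGraph.card_neighborFinset_eq_degree, card_neighborFinset_heawood]

theorem girthFive_heawood : GirthFive heawood := by
  constructor
  · intro a b c
    revert a b c; decide +kernel
  · have h : ∀ a b : ZMod 7 ⊕ ZMod 7, a ≠ b →
        (heawood.neighborFinset a ∩ heawood.neighborFinset b).card ≤ 1 := by decide +kernel
    intro a b x y hab hax hbx hay hby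
    exact card_le_one.1 (h a b hab) x (by simp [hax, hbx]) y (by simp [hay, hby])

/-- An injective homomorphism from the Heawood graph to a cubic graph is onto on neighbourhoods. -/
theorem adj_map_iff (hreg : G.IsRegularOfDegree 3) {f : ZMod 7 ⊕ ZMod 7 → V}
    (hf : Function.Injective f) (hom : ∀ a b, heawood.Adj a b → G.Adj (f a) (f b))
    {a : ZMod 7 ⊕ ZMod 7} {z : V} : G.Adj (f a) z ↔ ∃ b, heawood.Adj a b ∧ f b = z := by
  have h : (heawood.neighborFinset a).image f = G.neighborFinset (f a) := by
    refine eq_of_subset_of_card_le ?_ ?_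
    · intro z hz
      obtain ⟨b, hb, rfl⟩ := mem_image.1 hz
      simpa using hom a b (by simpa using hb)
    · rw [card_image_of_injective _ hf, card_neighborFinset_heawood,
        SimpleGraph.card_neighborFinset_eq_degree, hreg]
  rw [← SimpleGraph.mem_neighborFinset, ← h]
  simp

/-- An injective homomorphism from the Heawood graph to a cubic graph, as an induced embedding. -/
def embeddingOfInjective (hreg : G.IsRegularOfDegree 3) {f : ZMod 7 ⊕ ZMod 7 → V}
    (hf : Function.Injective f) (hom : ∀ a b, heawood.Adj a b → G.Adj (f a) (f b)) :
    heawood ↪g G where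
  toFun := f
  inj' := hf
  map_rel_iff' := by
    intro a b
    refine ⟨fun h => ?_, hom a b⟩
    obtain ⟨c, hc, h'⟩ := (adj_map_iff hreg hf hom).1 h
    rwa [← hf h']

theorem adj_embedding_iff (hreg : G.IsRegularOfDegree 3) (f : heawood ↪g G)
    {a : ZMod 7 ⊕ ZMod 7} {z : V} : G.Adj (f a) z ↔ ∃ b, heawood.Adj a b ∧ f b = z :=
  adj_map_iff hreg f.injective fun _ _ h => f.map_adj_iff.2 h

/-- A homomorphism from the Heawood graph that is injective on points is injective: a point and a line
are adjacent or the ends of a path of length three, so identifying them gives a loop or a triangle;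
and two distinct lines cover more than three points. -/
theorem injective_of_injective_points (hG : GirthFive G) (hreg : G.IsRegularOfDegree 3)
    {f : ZMod 7 ⊕ ZMod 7 → V} (hom : ∀ a b, heawood.Adj a b → G.Adj (f a) (f b))
    (hp : Function.Injective fun p => f (Sum.inl p)) : Function.Injective f := by
  have hpl : ∀ p l, f (Sum.inl p) ≠ f (Sum.inr l) := by
    intro p l h
    have hd : ∀ p l : ZMod 7, fanoIncident p l ∨
        ∃ p' l', fanoIncident p l' ∧ fanoIncident p' l' ∧ fanoIncident p' l := by decide +kernel
    rcases hd p l with h1 | ⟨p', l', h1, h2, h3⟩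
    · exact (hom (Sum.inl p) (Sum.inr l) h1).ne h
    · refine hG.no_triangle (hom (Sum.inl p) (Sum.inr l') h1) (hom (Sum.inr l') (Sum.inl p') h2) ?_
      rw [h]
      exact hom (Sum.inr l) (Sum.inl p') h3
  have hll : ∀ l l', f (Sum.inr l) = f (Sum.inr l') → l = l' := by
    intro l l' h
    by_contra hne
    have hd : ∀ l l' : ZMod 7, l ≠ l' →
        4 ≤ (univ.filter fun p => fanoIncident p l ∨ fanoIncident p l').card := by decide +kernel
    have h1 := hd l l' hne
    have h2 : ((univ.filter fun p => fanoIncident p l ∨ fanoIncident p l').image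
        fun p => f (Sum.inl p)) ⊆ G.neighborFinset (f (Sum.inr l)) := by
      intro z hz
      obtain ⟨p, hp, rfl⟩ := mem_image.1 hz
      rw [SimpleGraph.mem_neighborFinset]
      rcases (mem_filter.1 hp).2 with h3 | h3
      · exact hom (Sum.inr l) (Sum.inl p) h3
      · rw [h]
        exact hom (Sum.inr l') (Sum.inl p) h3
    have h3 := card_le_card h2
    rw [card_image_of_injective _ hp, SimpleGraph.card_neighborFinset_eq_degree, hreg] at h3
    omega
  rintro (p | l) (p' | l') h
  · exact congrArg _ (hp h)
  · exact absurd h (hpl p l')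
  · exact absurd h.symm (hpl p' l)
  · exact congrArg _ (hll l l' h)

namespace Labelling

variable {v : V} (l : Labelling G v)

/-- The position of a Fano point as seen from the point `0`: the root, or a second neighbour. -/
def pointCode (p : ZMod 7) : Option (Fin 3 × Bool) :=
  (![none, some (0, false), some (1, false), some (0, true), some (2, false), some (2, true),
    some (1, true)] : Fin 7 → Option (Fin 3 × Bool)) p

/-- The map from the Heawood graph that sends the point `0` to the root, the lines through it to the
`u i`, the other points to the `w i b`, and the remaining four lines to the `x k`. -/
def heawoodMap (x : Fin 4 → V) : ZMod 7 ⊕ ZMod 7 → V :=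
  Sum.elim (fun p => (pointCode p).elim v fun q => l.w q.1 q.2)
    (fun m => (![l.u 0, x 0, x 2, x 3, l.u 2, x 1, l.u 1] : Fin 7 → V) m)

/-- If four vertices are joined to the branches in the even-weight pattern `000, 011, 101, 110`, then
the root lies in a copy of the Heawood graph. -/
theorem exists_embedding_of_adj (hG : GirthFive G) (hreg : G.IsRegularOfDegree 3) (x : Fin 4 → V)
    (h0 : G.Adj (l.w 0 false) (x 0) ∧ G.Adj (l.w 1 false) (x 0) ∧ G.Adj (l.w 2 false) (x 0))
    (h1 : G.Adj (l.w 0 false) (x 1) ∧ G.Adj (l.w 1 true) (x 1) ∧ G.Adj (l.w 2 true) (x 1))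
    (h2 : G.Adj (l.w 0 true) (x 2) ∧ G.Adj (l.w 1 false) (x 2) ∧ G.Adj (l.w 2 true) (x 2))
    (h3 : G.Adj (l.w 0 true) (x 3) ∧ G.Adj (l.w 1 true) (x 3) ∧ G.Adj (l.w 2 false) (x 3)) :
    ∃ f : heawood ↪g G, f (Sum.inl 0) = v := by
  have hv := fun i => (l.adj_u_root i).symm
  have hu := fun i b => (l.adj_u_w i b).symm
  have hline : ∀ m : ZMod 7,
      G.Adj (l.heawoodMap x (Sum.inl m)) (l.heawoodMap x (Sum.inr m)) ∧
      G.Adj (l.heawoodMap x (Sum.inl (m + 1))) (l.heawoodMap x (Sum.inr m)) ∧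
      G.Adj (l.heawoodMap x (Sum.inl (m + 3))) (l.heawoodMap x (Sum.inr m)) := by
    intro m
    fin_cases m
    · exact ⟨hv 0, hu 0 false, hu 0 true⟩
    · exact ⟨h0.1, h0.2.1, h0.2.2⟩
    · exact ⟨h2.2.1, h2.1, h2.2.2⟩
    · exact ⟨h3.1, h3.2.2, h3.2.1⟩
    · exact ⟨hu 2 false, hu 2 true, hv 2⟩
    · exact ⟨h1.2.2, h1.2.1, h1.1⟩
    · exact ⟨hu 1 true, hv 1, hu 1 false⟩
  have hinc : ∀ p m, fanoIncident p m →
      G.Adj (l.heawoodMap x (Sum.inl p)) (l.heawoodMap x (Sum.inr m)) := by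
    rintro p m (rfl | rfl | rfl)
    exacts [(hline _).1, (hline _).2.1, (hline _).2.2]
  have hom : ∀ a b, heawood.Adj a b → G.Adj (l.heawoodMap x a) (l.heawoodMap x b) := by
    rintro (p | m) (p' | m') h
    · exact h.elim
    · exact hinc _ _ h
    · exact (hinc _ _ h).symm
    · exact h.elim
  have hinj : Function.Injective fun p => l.heawoodMap x (Sum.inl p) := by
    have hcode : Function.Injective pointCode := by decide +kernel
    refine Function.Injective.comp (g := fun o : Option (Fin 3 × Bool) =>
      o.elim v fun q => l.w q.1 q.2) ?_ hcode
    rintro (_ | ⟨i, b⟩) (_ | ⟨j, c⟩) h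
    · rfl
    · exact absurd h.symm (l.w_ne_root j c)
    · exact absurd h (l.w_ne_root i b)
    · obtain ⟨rfl, rfl⟩ := l.w_inj h
      rfl
  exact ⟨embeddingOfInjective hreg (injective_of_injective_points hG hreg hom hinj) hom, rfl⟩

/-- Exchange of the two elements in the branches where `p` is `true`. -/
def relabel (p : Fin 3 → Bool) : Labelling G v where
  u := l.u
  w i b := l.w i (xor b (p i))
  adj_root := l.adj_root
  adj_u i z := by
    rw [l.adj_u]
    refine or_congr_right ⟨?_, ?_⟩
    · rintro ⟨b, rfl⟩
      exact ⟨xor b (p i), by simp⟩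
    · rintro ⟨b, rfl⟩
      exact ⟨_, rfl⟩
  u_inj := l.u_inj
  w_inj h := by
    obtain ⟨rfl, h⟩ := l.w_inj h
    exact ⟨rfl, by simpa using h⟩
  w_ne_root _ _ := l.w_ne_root _ _
  w_ne_u _ _ _ := l.w_ne_u _ _ _

/-- At a vertex of slack zero, each second neighbour has two neighbours at distance three. -/
theorem outer_neighbours (hG : GirthFive G) (hreg : G.IsRegularOfDegree 3) {t : ℝ} (ht : 0 < t)
    (h : slack G t v = 0) (i : Fin 3) (b : Bool) :
    ∃ X : Bool → V, Function.Injective X ∧ ∀ k, X k ∈ l.outer ∧ G.Adj (l.w i b) (X k) := by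
  obtain ⟨X, hX, hX'⟩ := exists_enumeration (κ := Bool) ((G.neighborFinset (l.w i b)).erase (l.u i))
    (by
      rw [card_erase_of_mem (by simpa using (l.adj_u_w i b).symm),
        SimpleGraph.card_neighborFinset_eq_degree, hreg]
      simp)
  refine ⟨X, hX, fun k => ?_⟩
  obtain ⟨h1, h2⟩ := mem_erase.1 ((hX' _).2 ⟨k, rfl⟩)
  rw [SimpleGraph.mem_neighborFinset] at h2
  refine ⟨l.mem_outer.2 ⟨?_, ?_, ?_⟩, h2⟩
  · intro h3
    rw [h3] at h2
    obtain ⟨j, hj⟩ := (l.adj_root _).1 h2.symm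
    exact l.w_ne_u i b j hj.symm
  · intro j hj
    rw [← hj] at h2 h1
    rcases (l.adj_u j _).1 h2.symm with h3 | ⟨c, h3⟩
    · exact l.w_ne_root _ _ h3
    · exact h1 (by rw [(l.w_inj h3).1])
  · intro j c hj
    rw [← hj] at h2
    exact l.not_adj_w hG ht h _ _ _ _ h2

/-- A vertex of slack zero lies in a copy of the Heawood graph. The elements of branch `0` have distance
three neighbours `X k` and `Y k`, and as squares are excluded these are joined to the other two
branches in the even-weight pattern, after exchanging elements of branches. -/
theorem exists_embedding (l : Labelling G v) (hG : GirthFive G) (hreg : G.IsRegularOfDegree 3)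
    {t : ℝ} (ht : 0 < t) (h : slack G t v = 0) : ∃ f : heawood ↪g G, f (Sum.inl 0) = v := by
  obtain ⟨X, hX, hX1⟩ := l.outer_neighbours hG hreg ht h 0 false
  obtain ⟨Y, hY, hY1⟩ := l.outer_neighbours hG hreg ht h 0 true
  have hXe : ∀ k j, ∃ c, G.Adj (X k) (l.w j c) := fun k =>
    l.exists_adj_w hG ht h (hX1 k).1 (hX1 k).2.symm
  have hYe : ∀ k j, ∃ c, G.Adj (Y k) (l.w j c) := fun k =>
    l.exists_adj_w hG ht h (hY1 k).1 (hY1 k).2.symm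
  -- `β k j` and `γ k j` are the positions in branch `j` of the neighbours of `X k` and `Y k`.
  choose β hβ using hXe
  choose γ hγ using hYe
  have hwi : ∀ {i j b c}, i ≠ j → l.w i b ≠ l.w j c := fun hij h => hij (l.w_inj h).1
  have hββ : ∀ j, j ≠ 0 → β true j = !β false j := fun j hj => Bool.eq_not.2 fun e =>
    hwi hj (hG.no_square (hX.ne Bool.false_ne_true.symm) (hβ true j) (e ▸ hβ false j)
      (hX1 true).2.symm (hX1 false).2.symm)
  have hγγ : ∀ j, j ≠ 0 → γ true j = !γ false j := fun j hj => Bool.eq_not.2 fun e =>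
    hwi hj (hG.no_square (hY.ne Bool.false_ne_true.symm) (hγ true j) (e ▸ hγ false j)
      (hY1 true).2.symm (hY1 false).2.symm)
  have hXY : ∀ k m, X k ≠ Y m := fun k m e => Bool.false_ne_true <|
    l.eq_of_adj_w hG ((l.mem_outer.1 (hX1 k).1).2.1 0) (hX1 k).2.symm (e ▸ (hY1 m).2.symm)
  obtain ⟨m, hm⟩ : ∃ m, γ m 1 = β false 1 := by
    by_cases e : γ false 1 = β false 1
    · exact ⟨false, e⟩
    · refine ⟨true, ?_⟩
      rw [hγγ 1 (by decide), Bool.eq_not.2 e, Bool.not_not]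
  have hm2 : γ m 2 = !β false 2 := Bool.eq_not.2 fun e =>
    hwi (by decide : (1 : Fin 3) ≠ 2) (hG.no_square (hXY false m) (hβ false 1) (hm ▸ hγ m 1)
      (hβ false 2) (e ▸ hγ m 2))
  have hneg : ∀ j, j ≠ 0 → γ (!m) j = !γ m j := by
    intro j hj
    cases m
    · exact hγγ j hj
    · simp [hγγ j hj]
  let l' := l.relabel ![false, β false 1, β false 2]
  refine l'.exists_embedding_of_adj hG hreg ![X false, X true, Y m, Y (!m)]
    ⟨?_, ?_, ?_⟩ ⟨?_, ?_, ?_⟩ ⟨?_, ?_, ?_⟩ ⟨?_, ?_, ?_⟩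
  · simpa [l', relabel] using (hX1 false).2
  · simpa [l', relabel] using (hβ false 1).symm
  · simpa [l', relabel] using (hβ false 2).symm
  · simpa [l', relabel] using (hX1 true).2
  · simpa [l', relabel, ← hββ] using (hβ true 1).symm
  · simpa [l', relabel, ← hββ] using (hβ true 2).symm
  · simpa [l', relabel] using (hY1 m).2
  · simpa [l', relabel, hm] using (hγ m 1).symm
  · simpa [l', relabel, hm2] using (hγ m 2).symm
  · simpa [l', relabel] using (hY1 (!m)).2
  · simpa [l', relabel, hneg, hm] using (hγ (!m) 1).symm
  · simpa [l', relabel, hneg, hm2] using (hγ (!m) 2).symm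

/-- The standard labelling of the Heawood graph. -/
def ofHeawood : Labelling heawood (Sum.inl 0) where
  u := ![Sum.inr 0, Sum.inr 6, Sum.inr 4]
  w := ![fun b => bif b then Sum.inl 3 else Sum.inl 1, fun b => bif b then Sum.inl 6 else Sum.inl 2,
    fun b => bif b then Sum.inl 5 else Sum.inl 4]
  adj_root := by decide +kernel
  adj_u := by decide +kernel
  u_inj := by decide +kernel
  w_inj := by decide +kernel
  w_ne_root := by decide +kernel
  w_ne_u := by decide +kernel

/-- The image of a labelling under an embedding of the Heawood graph in a cubic graph. -/
def map (hreg : G.IsRegularOfDegree 3) (f : heawood ↪g G) {a : ZMod 7 ⊕ ZMod 7}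
    (l : Labelling heawood a) : Labelling G (f a) where
  u i := f (l.u i)
  w i b := f (l.w i b)
  adj_root z := by
    rw [adj_embedding_iff hreg]
    simp [l.adj_root]
  adj_u i z := by
    rw [adj_embedding_iff hreg]
    simp only [l.adj_u]
    constructor
    · rintro ⟨b, rfl | ⟨c, rfl⟩, rfl⟩
      · exact Or.inl rfl
      · exact Or.inr ⟨c, rfl⟩
    · rintro (rfl | ⟨c, rfl⟩)
      · exact ⟨a, Or.inl rfl, rfl⟩
      · exact ⟨_, Or.inr ⟨c, rfl⟩, rfl⟩
  u_inj := f.injective.comp l.u_inj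
  w_inj h := l.w_inj (f.injective h)
  w_ne_root i b h := l.w_ne_root i b (f.injective h)
  w_ne_u i b j h := l.w_ne_u i b j (f.injective h)

end Labelling

theorem slack_embedding (hG : GirthFive G) (hreg : G.IsRegularOfDegree 3) (t : ℝ)
    (f : heawood ↪g G) : slack G t (f (Sum.inl 0)) = 0 := by
  let l := Labelling.ofHeawood.map hreg f
  rw [l.slack_eq hG, sum_eq_zero, mul_zero]
  intro J hJ
  have hJ' : J ⊆ l.outer := by simpa using (mem_filter.1 hJ).1
  -- Besides `u i`, the vertex `w i b` has two neighbours, the images of lines `m` and `m'`.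
  have hw : ∀ i b (m m' : ZMod 7),
      (∀ c, heawood.Adj (Labelling.ofHeawood.w i b) c →
        c = Labelling.ofHeawood.u i ∨ c = Sum.inr m ∨ c = Sum.inr m') →
      heawood.Adj (Labelling.ofHeawood.w i b) (Sum.inr m) →
      heawood.Adj (Labelling.ofHeawood.w i b) (Sum.inr m') →
      decide (∀ x ∈ J, ¬ G.Adj x (l.w i b)) =
        !(decide (f (Sum.inr m) ∈ J) || decide (f (Sum.inr m') ∈ J)) := by
    intro i b m m' h h1 h2
    rw [← Bool.decide_or, ← decide_not, decide_eq_decide]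
    constructor
    · rintro h3 (h4 | h4)
      · exact h3 _ h4 (f.map_adj_iff.2 h1.symm)
      · exact h3 _ h4 (f.map_adj_iff.2 h2.symm)
    · intro h3 x hx hadj
      obtain ⟨c, hc, rfl⟩ := (adj_embedding_iff hreg f).1 hadj.symm
      rcases h c hc with rfl | rfl | rfl
      · exact (l.mem_outer.1 (hJ' hx)).2.1 i rfl
      · exact h3 (Or.inl hx)
      · exact h3 (Or.inr hx)
  have hav0 : l.avail J 0 = (!(decide (f (Sum.inr 1) ∈ J) || decide (f (Sum.inr 5) ∈ J)),
      !(decide (f (Sum.inr 2) ∈ J) || decide (f (Sum.inr 3) ∈ J))) :=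
    Prod.ext (hw 0 false 1 5 (by decide +kernel) (by decide +kernel) (by decide +kernel))
      (hw 0 true 2 3 (by decide +kernel) (by decide +kernel) (by decide +kernel))
  have hav1 : l.avail J 1 = (!(decide (f (Sum.inr 1) ∈ J) || decide (f (Sum.inr 2) ∈ J)),
      !(decide (f (Sum.inr 5) ∈ J) || decide (f (Sum.inr 3) ∈ J))) :=
    Prod.ext (hw 1 false 1 2 (by decide +kernel) (by decide +kernel) (by decide +kernel))
      (hw 1 true 5 3 (by decide +kernel) (by decide +kernel) (by decide +kernel))
  have hav2 : l.avail J 2 = (!(decide (f (Sum.inr 1) ∈ J) || decide (f (Sum.inr 3) ∈ J)),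
      !(decide (f (Sum.inr 5) ∈ J) || decide (f (Sum.inr 2) ∈ J))) :=
    Prod.ext (hw 2 false 1 3 (by decide +kernel) (by decide +kernel) (by decide +kernel))
      (hw 2 true 5 2 (by decide +kernel) (by decide +kernel) (by decide +kernel))
  have hne : ∀ i j b c, ¬ G.Adj (l.w i b) (l.w j c) := by
    intro i j b c h
    have h' : ∀ i j b c, ¬ heawood.Adj (Labelling.ofHeawood.w i b) (Labelling.ofHeawood.w j c) := by
      decide +kernel
    exact h' i j b c (f.map_adj_iff.1 h)
  have hed : ∀ i j, l.edges i j = noEdge := by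
    intro i j
    simp [Labelling.edges, noEdge, hne]
  rw [Labelling.farWeight, hav0, hav1, hav2, hed, hed, hed, evalP_coefs_heawood, mul_zero]

end Embedding

/-! ### Global consequences -/

section Global

variable {V : Type*} [Fintype V] [DecidableEq V] {G : SimpleGraph V} [DecidableRel G.Adj]

theorem slack_nonneg (hG : GirthFive G) (hreg : G.IsRegularOfDegree 3) {t : ℝ} (ht : 0 < t)
    (v : V) : 0 ≤ slack G t v := by
  obtain ⟨l⟩ := exists_labelling hG hreg v
  rw [l.slack_eq hG]
  refine mul_nonneg (by positivity) (sum_nonneg fun J _ => ?_)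
  have := l.farWeight_nonneg hG ht J
  positivity

theorem slack_eq_zero_iff (hG : GirthFive G) (hreg : G.IsRegularOfDegree 3) {t : ℝ} (ht : 0 < t)
    (v : V) : slack G t v = 0 ↔ ∃ f : heawood ↪g G, f (Sum.inl 0) = v := by
  constructor
  · intro h
    obtain ⟨l⟩ := exists_labelling hG hreg v
    exact l.exists_embedding hG hreg ht h
  · rintro ⟨f, rfl⟩
    exact slack_embedding hG hreg t f

/-- The terms with multipliers cancel, since in a cubic graph each vertex is a neighbour three times. -/
theorem sum_charge (hreg : G.IsRegularOfDegree 3) (t : ℝ) (I : Finset V) :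
    ∑ v, charge G t I v = 3 * (Fintype.card V * occNum t - occDen t * I.card) := by
  have h1 : ∑ v, ∑ u ∈ G.neighborFinset v, multiplier t (occ G I u) =
      3 * ∑ u, multiplier t (occ G I u) := by
    have h2 : ∀ v, ∑ u ∈ G.neighborFinset v, multiplier t (occ G I u) =
        ∑ u, if G.Adj v u then multiplier t (occ G I u) else 0 := by
      intro v
      rw [← sum_filter]
      congr 1
      ext; simp
    rw [sum_congr rfl fun v _ => h2 v, sum_comm, mul_sum]
    refine sum_congr rfl fun u _ => ?_
    have h3 : (univ.filter fun v => G.Adj v u) = G.neighborFinset u := by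
      ext; simp [SimpleGraph.adj_comm]
    rw [← sum_filter, sum_const, h3, SimpleGraph.card_neighborFinset_eq_degree, hreg]
    simp
  have h4 : ∑ v, (if v ∈ I then (1 : ℝ) else 0) = I.card := by simp
  simp only [charge, sum_add_distrib, sum_sub_distrib, ← mul_sum, h1, h4]
  simp
  ring

theorem indepPoly_pos (G : SimpleGraph V) [DecidableRel G.Adj] {t : ℝ} (ht : 0 < t) :
    0 < indepPoly G t :=
  sum_pos (fun I _ => by positivity) ⟨∅, (mem_indepSets G).2 (by simp [Ind])⟩

theorem occupancyFraction_eq [Nonempty V] (hreg : G.IsRegularOfDegree 3) {t : ℝ} (ht : 0 < t) :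
    occupancyFraction G t = occNum t / occDen t -
      (∑ v, slack G t v) / (3 * Fintype.card V * occDen t * indepPoly G t) := by
  have hP := indepPoly_pos G ht
  have hD := occDen_pos ht
  have hn : (0 : ℝ) < Fintype.card V := by exact_mod_cast Fintype.card_pos
  have h1 : ∑ v, slack G t v = 3 * (Fintype.card V * occNum t * indepPoly G t -
      occDen t * ∑ I ∈ indepSets G, t ^ I.card * I.card) := by
    simp only [slack]
    rw [sum_comm]
    simp only [← mul_sum, sum_charge hreg, indepPoly]
    simp only [mul_sub, mul_sum, ← sum_sub_distrib]
    refine sum_congr rfl fun I _ => by ring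
  have h2 : occupancyFraction G t =
      (∑ I ∈ indepSets G, t ^ I.card * I.card) / (Fintype.card V * indepPoly G t) := by
    rw [occupancyFraction, sum_div, mul_sum]
    refine sum_congr rfl fun I _ => ?_
    rw [prob]
    field_simp
  rw [h1, h2]
  field_simp
  ring

theorem occupancyFraction_le [Nonempty V] (hG : GirthFive G) (hreg : G.IsRegularOfDegree 3) {t : ℝ}
    (ht : 0 < t) : occupancyFraction G t ≤ occNum t / occDen t := by
  rw [occupancyFraction_eq hreg ht, sub_le_self_iff]
  have hP := indepPoly_pos G ht
  have hD := occDen_pos ht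
  have := sum_nonneg fun v (_ : v ∈ univ) => slack_nonneg hG hreg ht v
  positivity

theorem occupancyFraction_eq_iff [Nonempty V] (hG : GirthFive G) (hreg : G.IsRegularOfDegree 3)
    {t : ℝ} (ht : 0 < t) : occupancyFraction G t = occNum t / occDen t ↔
      ∀ v, ∃ f : heawood ↪g G, f (Sum.inl 0) = v := by
  have hP := indepPoly_pos G ht
  have hD := occDen_pos ht
  have hn : (0 : ℝ) < Fintype.card V := by exact_mod_cast Fintype.card_pos
  rw [occupancyFraction_eq hreg ht, sub_eq_self, div_eq_zero_iff, or_iff_left (by positivity),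
    sum_eq_zero_iff_of_nonneg fun v _ => slack_nonneg hG hreg ht v]
  simp [slack_eq_zero_iff hG hreg ht]

/-- The Heawood graph is vertex transitive, by translations of `ZMod 7` and the dualities
`x ↦ m - x` between points and lines. -/
theorem exists_automorphism (a : ZMod 7 ⊕ ZMod 7) :
    ∃ f : heawood ↪g heawood, f (Sum.inl 0) = a := by
  rcases a with p | m
  · refine ⟨⟨⟨Sum.map (· + p) (· + p), ?_⟩, ?_⟩, congrArg Sum.inl (zero_add p)⟩
    · revert p; decide +kernel
    · revert p; decide +kernel
  · refine ⟨⟨⟨Sum.elim (fun x => Sum.inr (m - x)) (fun x => Sum.inl (m - x)), ?_⟩, ?_⟩,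
      congrArg Sum.inr (sub_zero m)⟩
    · revert m; decide +kernel
    · revert m; decide +kernel

theorem occupancyFraction_heawood {t : ℝ} (ht : 0 < t) :
    occupancyFraction heawood t = occNum t / occDen t :=
  (occupancyFraction_eq_iff girthFive_heawood heawood_isRegular ht).2 exists_automorphism

theorem heawood_preconnected : heawood.Preconnected := by
  have h : ∀ a : ZMod 7 ⊕ ZMod 7, heawood.Reachable (Sum.inl 0) a := by
    have hd : ∀ p : ZMod 7, ∃ m, fanoIncident 0 m ∧ fanoIncident p m := by decide +kernel
    have hp : ∀ p : ZMod 7, heawood.Reachable (Sum.inl 0) (Sum.inl p) := by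
      intro p
      obtain ⟨m, h1, h2⟩ := hd p
      have e1 : heawood.Adj (Sum.inl 0) (Sum.inr m) := h1
      have e2 : heawood.Adj (Sum.inr m) (Sum.inl p) := h2
      exact e1.reachable.trans e2.reachable
    rintro (p | m)
    · exact hp p
    · have e : heawood.Adj (Sum.inl m) (Sum.inr m) := Or.inl rfl
      exact (hp m).trans e.reachable
  exact fun a b => (h a).symm.trans (h b)

/-- A copy of the Heawood graph in a cubic graph is connected and closed under adjacency, hence a
component. -/
theorem isUnionOfCopies_of_embeddings (hreg : G.IsRegularOfDegree 3)
    (h : ∀ v, ∃ f : heawood ↪g G, f (Sum.inl 0) = v) : IsUnionOfCopies G heawood := by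
  choose f hf using h
  have hreach : ∀ v a, G.Reachable v (f v a) := fun v a => by
    have := (heawood_preconnected (Sum.inl 0) a).map (f v).toHom
    simpa [hf] using this
  have hrange : ∀ v z, G.Reachable v z → ∃ a, f v a = z := by
    intro v z hz
    rw [SimpleGraph.reachable_iff_reflTransGen] at hz
    induction hz with
    | refl => exact ⟨_, hf v⟩
    | tail _ hadj ih =>
      obtain ⟨a, rfl⟩ := ih
      obtain ⟨b, -, rfl⟩ := (adj_embedding_iff hreg (f v)).1 hadj
      exact ⟨b, rfl⟩
  classical
  let e := Fintype.equivFin G.ConnectedComponent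
  let g : Fin (Fintype.card G.ConnectedComponent) × (ZMod 7 ⊕ ZMod 7) → V :=
    fun p => f (e.symm p.1).out p.2
  have hcomp : ∀ p, G.connectedComponentMk (g p) = e.symm p.1 := by
    intro p
    have h1 : G.connectedComponentMk (e.symm p.1).out = e.symm p.1 := Quot.out_eq _
    rw [← h1]
    exact (SimpleGraph.ConnectedComponent.eq.2 (hreach _ _)).symm
  have hg1 : Function.Injective g := by
    rintro ⟨i, a⟩ ⟨j, b⟩ hij
    have h1 : e.symm i = e.symm j := by
      rw [← hcomp ⟨i, a⟩, ← hcomp ⟨j, b⟩, hij]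
    obtain rfl := e.symm.injective h1
    exact Prod.ext rfl ((f _).injective hij)
  have hg2 : Function.Surjective g := by
    intro v
    have h1 : G.Reachable (G.connectedComponentMk v).out v :=
      SimpleGraph.ConnectedComponent.eq.1 (Quot.out_eq _)
    obtain ⟨a, ha⟩ := hrange _ v h1
    exact ⟨(e (G.connectedComponentMk v), a), by simpa [g] using ha⟩
  refine ⟨Fintype.card G.ConnectedComponent, ⟨SimpleGraph.Iso.symm
    ⟨Equiv.ofBijective g ⟨hg1, hg2⟩, ?_⟩⟩⟩
  rintro ⟨i, a⟩ ⟨j, b⟩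
  change G.Adj (g (i, a)) (g (j, b)) ↔ i = j ∧ heawood.Adj a b
  constructor
  · intro hadj
    have h1 : e.symm i = e.symm j := by
      rw [← hcomp ⟨i, a⟩, ← hcomp ⟨j, b⟩]
      exact SimpleGraph.ConnectedComponent.eq.2 hadj.reachable
    obtain rfl := e.symm.injective h1
    exact ⟨rfl, (f _).map_adj_iff.1 hadj⟩
  · rintro ⟨rfl, hab⟩
    exact (f _).map_adj_iff.2 hab

theorem embeddings_of_isUnionOfCopies (h : IsUnionOfCopies G heawood) (v : V) :
    ∃ f : heawood ↪g G, f (Sum.inl 0) = v := by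
  obtain ⟨k, ⟨e⟩⟩ := h
  obtain ⟨f, hf⟩ := exists_automorphism (e v).2
  let g : heawood ↪g copies k heawood :=
    ⟨⟨fun a => ((e v).1, a), fun a b h => (Prod.mk.inj h).2⟩, by simp [copies]⟩
  refine ⟨e.symm.toEmbedding.comp (g.comp f), ?_⟩
  change e.symm ((e v).1, f (Sum.inl 0)) = v
  rw [hf]
  exact e.symm_apply_apply v

end Global

end HardCore

theorem theorem3 {V : Type*} [Fintype V] [DecidableEq V] [Nonempty V]
    (G : SimpleGraph V) [DecidableRel G.Adj]
    (hcubic : G.IsRegularOfDegree 3) (hgirth : 5 ≤ G.egirth)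
    (t : ℝ) (ht : 0 < t) :
    HardCore.occupancyFraction G t ≤ HardCore.occupancyFraction HardCore.heawood t ∧
      (HardCore.occupancyFraction G t = HardCore.occupancyFraction HardCore.heawood t ↔
        HardCore.IsUnionOfCopies G HardCore.heawood) := by
  have hG := HardCore.girthFive_of_egirth hgirth
  rw [HardCore.occupancyFraction_heawood ht, HardCore.occupancyFraction_eq_iff hG hcubic ht]
  exact ⟨HardCore.occupancyFraction_le hG hcubic ht,
    HardCore.isUnionOfCopies_of_embeddings hcubic, HardCore.embeddings_of_isUnionOfCopies⟩
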